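/- A simple allowable sequence on $[n]=\{1,\dots,n\}$ is a doubly infinite sequence $\Pi=(\dots,\pi_{-1},\pi_0,\pi_1,\dots)$ of permutations of $[n]$ such that any two consecutive permutations $\pi_j,\pi_{j+1}$ differ by a transposition of the elements in two neighboring positions, and such that, for every $j$, $\pi_j$ is the reverse of $\pi_{j+\binom n2}$. For $1\le k\le n/2$, a transposition of the elements in positions $k$ and $k+1$, or in positions $n-k$ and $n-k+1$, is called $k$-critical. The number $h(\Pi)$ of halving lines of $\Pi$ is the number of $\lfloor n/2\rfloor$-critical transpositions among the $\binom n2$ transpositions leading from $\pi_i$ to $\pi_{i+\binom n2}$; it does not depend on $i$. If $n\ge 8$ and $\Pi$ is a simple allowable sequence on $[n]$, then $$h(\Pi)\le\begin{cases}\left\lfloor \frac1{24}n(n+30)-3\right\rfloor & \text{if } n \text{ is even},\\[4pt] \left\lfloor \frac1{18}(n-3)(n+45)+\frac19\right\rfloor & \text{if } n \text{ is odd}.\end{cases}$$ -/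

import Mathlib

/-- A simple allowable sequence on `n` labels: a doubly infinite sequence of permutations such that
consecutive permutations differ by a transposition of the labels in two neighbouring positions, and
`perm j` is the reverse of `perm (j + n.choose 2)`.
`perm j p` is the label in position `p` of the `j`-th permutation, where the position `p : Fin n`
stands for the position `p + 1` of `{1, ..., n}`. -/
structure SimpleAllowableSequence (n : ℕ) where
  perm : ℤ → Equiv.Perm (Fin n)
  adjacent : ∀ j : ℤ, ∃ p q : Fin n, (q : ℕ) = p + 1 ∧ perm (j + 1) = perm j * Equiv.swap p q
  reverse : ∀ (j : ℤ) (p : Fin n), perm j p = perm (j + (n.choose 2 : ℕ)) (Fin.rev p)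

namespace SimpleAllowableSequence

variable {n : ℕ}

/-- The transposition from `perm j` to `perm (j + 1)` is a `k`-transposition: it exchanges the
labels in positions `k` and `k + 1`, where positions are numbered `1, ..., n` (in `Fin n` these are
the indices `k - 1` and `k`). -/
def IsTransposition (S : SimpleAllowableSequence n) (k : ℕ) (j : ℤ) : Prop :=
  ∃ p q : Fin n, (p : ℕ) + 1 = k ∧ (q : ℕ) = k ∧ S.perm (j + 1) = S.perm j * Equiv.swap p q

/-- The transposition from `perm j` to `perm (j + 1)` is `k`-critical (for `1 ≤ k ≤ n / 2`): it is a
`k`-transposition or an `(n - k)`-transposition. -/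
def IsCritical (S : SimpleAllowableSequence n) (k : ℕ) (j : ℤ) : Prop :=
  S.IsTransposition k j ∨ S.IsTransposition (n - k) j

open Classical in
/-- The number of `(k + 1)`-critical transpositions in the halfperiod
`(perm i, ..., perm (i + n.choose 2))`. -/
noncomputable def numEdgesFrom (S : SimpleAllowableSequence n) (k : ℕ) (i : ℤ) : ℕ :=
  ((Finset.Ico i (i + (n.choose 2 : ℕ))).filter fun j => S.IsCritical (k + 1) j).card

/-- `E_k(S)`, the number of `(k + 1)`-critical transpositions in a halfperiod. By
`numEdgesFrom_eq_numEdges` below the choice of the halfperiod is irrelevant. -/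
noncomputable def numEdges (S : SimpleAllowableSequence n) (k : ℕ) : ℕ :=
  S.numEdgesFrom k 0

/-- The number `h(S) = E_{⌊n/2⌋ - 1}(S)` of halving lines of `S`. -/
noncomputable def numHalvingLines (S : SimpleAllowableSequence n) : ℕ :=
  S.numEdges (n / 2 - 1)

theorem perm_add (S : SimpleAllowableSequence n) (j : ℤ) :
    S.perm (j + (n.choose 2 : ℕ)) = S.perm j * Fin.revPerm := by
  ext p
  simp [S.reverse j (Fin.rev p)]

theorem isTransposition_add (S : SimpleAllowableSequence n) {k : ℕ} {j : ℤ}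
    (h : S.IsTransposition k j) : S.IsTransposition (n - k) (j + (n.choose 2 : ℕ)) := by
  obtain ⟨p, q, hp, hq, h⟩ := h
  refine ⟨Fin.rev q, Fin.rev p, ?_, ?_, ?_⟩
  · rw [Fin.val_rev]; omega
  · rw [Fin.val_rev]; omega
  · rw [show j + (n.choose 2 : ℕ) + 1 = (j + 1) + (n.choose 2 : ℕ) by ring, perm_add, perm_add, h,
      mul_assoc, mul_assoc, Equiv.swap_comm]
    congr 1
    have := Equiv.mul_swap_eq_swap_mul (Fin.revPerm (n := n)) (Fin.rev q) (Fin.rev p)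
    simpa using this.symm

theorem isTransposition_sub (S : SimpleAllowableSequence n) {k : ℕ} {j : ℤ}
    (h : S.IsTransposition k (j + (n.choose 2 : ℕ))) : S.IsTransposition (n - k) j := by
  obtain ⟨p, q, hp, hq, h⟩ := h
  refine ⟨Fin.rev q, Fin.rev p, ?_, ?_, ?_⟩
  · rw [Fin.val_rev]; omega
  · rw [Fin.val_rev]; omega
  · rw [show j + (n.choose 2 : ℕ) + 1 = (j + 1) + (n.choose 2 : ℕ) by ring, perm_add, perm_add,
      mul_assoc] at h
    have := Equiv.mul_swap_eq_swap_mul (Fin.revPerm (n := n)) p q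
    rw [this, ← mul_assoc] at h
    have h2 := mul_right_cancel h
    rw [h2, Equiv.swap_comm]
    simp

theorem isTransposition_pos_lt (S : SimpleAllowableSequence n) {k : ℕ} {j : ℤ}
    (h : S.IsTransposition k j) : 1 ≤ k ∧ k < n := by
  obtain ⟨p, q, hp, hq, -⟩ := h
  omega

theorem isCritical_add_iff (S : SimpleAllowableSequence n) (k : ℕ) (j : ℤ) :
    S.IsCritical k (j + (n.choose 2 : ℕ)) ↔ S.IsCritical k j := by
  constructor
  · rintro (h | h)
    · exact Or.inr (S.isTransposition_sub h)
    · have h1 := S.isTransposition_pos_lt h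
      have h2 := S.isTransposition_sub h
      rw [show n - (n - k) = k by omega] at h2
      exact Or.inl h2
  · rintro (h | h)
    · exact Or.inr (S.isTransposition_add h)
    · have h1 := S.isTransposition_pos_lt h
      have h2 := S.isTransposition_add h
      rw [show n - (n - k) = k by omega] at h2
      exact Or.inl h2

theorem numEdgesFrom_add_one (S : SimpleAllowableSequence n) (k : ℕ) (i : ℤ) :
    S.numEdgesFrom k (i + 1) = S.numEdgesFrom k i := by
  classical
  have hN : (0 : ℤ) ≤ (n.choose 2 : ℕ) := by positivity
  rcases hN.eq_or_lt with h0 | h0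
  · simp [numEdgesFrom, ← h0]
  · have e1 : Finset.Ico i (i + (n.choose 2 : ℕ)) =
        insert i (Finset.Ico (i + 1) (i + (n.choose 2 : ℕ))) := by
      ext x; simp only [Finset.mem_Ico, Finset.mem_insert]; omega
    have e2 : Finset.Ico (i + 1) (i + 1 + (n.choose 2 : ℕ)) =
        insert (i + (n.choose 2 : ℕ)) (Finset.Ico (i + 1) (i + (n.choose 2 : ℕ))) := by
      ext x; simp only [Finset.mem_Ico, Finset.mem_insert]; omega
    have hc := S.isCritical_add_iff (k + 1) i
    unfold numEdgesFrom
    rw [e1, e2, Finset.filter_insert, Finset.filter_insert]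
    by_cases h : S.IsCritical (k + 1) i
    · rw [if_pos h, if_pos (hc.2 h), Finset.card_insert_of_notMem (by simp),
        Finset.card_insert_of_notMem (by simp)]
    · rw [if_neg h, if_neg (fun h' => h (hc.1 h'))]

/-- Every halfperiod has the same number of `(k + 1)`-critical transpositions. -/
theorem numEdgesFrom_eq_numEdges (S : SimpleAllowableSequence n) (k : ℕ) (i : ℤ) :
    S.numEdgesFrom k i = S.numEdges k := by
  unfold numEdges
  induction i using Int.induction_on with
  | zero => rfl
  | succ i ih => rw [numEdgesFrom_add_one, ih]
  | pred i ih => rw [← ih, ← numEdgesFrom_add_one, sub_add_cancel]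

end SimpleAllowableSequence

/-! Put m = ⌊n/2⌋ and sort the n(n-1) transpositions of a full period by their positions. This gives
n(n-1) = 2N + B + 2h (`two_mul_choose_eq`). Here h is the number of halving lines, B counts the
transpositions that move a label into or out of the central positions (two of them if n is even,
three if n is odd), and N counts those with fewer than k = m - 2 labels to their left; by reflection
the right end contributes N as well. An upper bound for h thus follows from a lower bound for N and
a lower bound for B in terms of h.

For N, there are three labels, each leftmost at some time, that leave the left end at well spread
times (`exists_three_exits`). They account for at least 6k - 3 shallow transpositions. After their
deletion the transpositions with fewer than k - 2 labels to their left are still shallow in the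
original sequence, since at every time one of the three labels is far away; at times when two are
far away one more level counts, which yields 3k - n further transpositions if that is positive. This
is `numShallow_recursion`, and induction gives 6N ≥ 9k(k+1) + (3k-n)(3k-n+3) for n ≤ 3k + 3
(`numShallow_ge`).

For B, keep the set of pairs that have been swapped since both labels became central. A central
transposition adds a pair, and a border transposition destroys at most n - 2m + 1 pairs. As
everything is periodic, 2h ≤ (n - 2m + 1) B (`card_isCentralSwap_le`). This fails only if two labels
are central forever, and then h is at most linear in n (`numHalvingLines_le_of_permanent`). -/

namespace SimpleAllowableSequence

variable {n : ℕ}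

/-! ### Positions of labels and the symmetry under a halfperiod. -/

/-- The position (numbered from `0`) of the label `x` at time `t`. -/
def pos (S : SimpleAllowableSequence n) (t : ℤ) (x : Fin n) : ℕ := ((S.perm t).symm x : Fin n)

theorem pos_lt (S : SimpleAllowableSequence n) (t : ℤ) (x : Fin n) : S.pos t x < n :=
  ((S.perm t).symm x).isLt

theorem pos_injective (S : SimpleAllowableSequence n) (t : ℤ) : Function.Injective (S.pos t) :=
  fun _ _ h => (S.perm t).symm.injective (Fin.ext h)

theorem pos_inj (S : SimpleAllowableSequence n) {t : ℤ} {x y : Fin n} :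
    S.pos t x = S.pos t y ↔ x = y := (S.pos_injective t).eq_iff

theorem pos_perm (S : SimpleAllowableSequence n) (t : ℤ) (p : Fin n) :
    S.pos t (S.perm t p) = p := by simp [pos]

/-- The label that moves to the right between the times `t` and `t + 1`. -/
noncomputable def lo (S : SimpleAllowableSequence n) (t : ℤ) : Fin n :=
  S.perm t (S.adjacent t).choose

/-- The label that moves to the left between the times `t` and `t + 1`. -/
noncomputable def hi (S : SimpleAllowableSequence n) (t : ℤ) : Fin n :=
  S.perm t (S.adjacent t).choose_spec.choose

theorem perm_succ (S : SimpleAllowableSequence n) (t : ℤ) :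
    S.perm (t + 1) =
      S.perm t * Equiv.swap ((S.perm t).symm (S.lo t)) ((S.perm t).symm (S.hi t)) := by
  have h := (S.adjacent t).choose_spec.choose_spec.2
  simpa [lo, hi] using h

theorem pos_hi (S : SimpleAllowableSequence n) (t : ℤ) :
    S.pos t (S.hi t) = S.pos t (S.lo t) + 1 := by
  have h := (S.adjacent t).choose_spec.choose_spec.1
  simpa [lo, hi, pos] using h

theorem pos_succ_lo (S : SimpleAllowableSequence n) (t : ℤ) :
    S.pos (t + 1) (S.lo t) = S.pos t (S.lo t) + 1 := by
  rw [← S.pos_hi t]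
  unfold pos
  rw [S.perm_succ t]
  congr 1
  rw [Equiv.symm_apply_eq]
  simp

theorem pos_succ_hi (S : SimpleAllowableSequence n) (t : ℤ) :
    S.pos (t + 1) (S.hi t) = S.pos t (S.lo t) := by
  unfold pos
  rw [S.perm_succ t]
  congr 1
  rw [Equiv.symm_apply_eq]
  simp

theorem pos_succ_of_ne (S : SimpleAllowableSequence n) {t : ℤ} {x : Fin n} (h1 : x ≠ S.lo t)
    (h2 : x ≠ S.hi t) : S.pos (t + 1) x = S.pos t x := by
  unfold pos
  rw [S.perm_succ t]
  congr 1
  rw [Equiv.symm_apply_eq]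
  rw [Equiv.Perm.mul_apply, Equiv.swap_apply_of_ne_of_ne]
  · simp
  · simpa using h1
  · simpa using h2

theorem lo_ne_hi (S : SimpleAllowableSequence n) (t : ℤ) : S.lo t ≠ S.hi t := by
  intro h
  have := S.pos_hi t
  rw [h] at this
  omega

/-- The choice made in `lo` is immaterial: the label is recognised by its displacement. -/
theorem eq_lo_iff (S : SimpleAllowableSequence n) {t : ℤ} {x : Fin n} :
    x = S.lo t ↔ S.pos t x < S.pos (t + 1) x := by
  have h1 := S.pos_succ_lo t
  have h2 := S.pos_succ_hi t
  have h3 := S.pos_hi t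
  constructor
  · rintro rfl; omega
  · intro h
    by_contra h4
    by_cases h5 : x = S.hi t
    · subst h5; omega
    · rw [S.pos_succ_of_ne h4 h5] at h; omega

theorem eq_hi_iff (S : SimpleAllowableSequence n) {t : ℤ} {x : Fin n} :
    x = S.hi t ↔ S.pos (t + 1) x < S.pos t x := by
  have h1 := S.pos_succ_lo t
  have h2 := S.pos_succ_hi t
  have h3 := S.pos_hi t
  constructor
  · rintro rfl; omega
  · intro h
    by_contra h4
    by_cases h5 : x = S.lo t
    · subst h5; omega
    · rw [S.pos_succ_of_ne h5 h4] at h; omega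

theorem isTransposition_iff (S : SimpleAllowableSequence n) {k : ℕ} {t : ℤ} :
    S.IsTransposition k t ↔ S.pos t (S.lo t) + 1 = k := by
  constructor
  · rintro ⟨p, q, hp, hq, h⟩
    have : S.perm t p = S.lo t := by
      rw [eq_lo_iff, pos_perm]
      have : S.perm t p = S.perm (t + 1) q := by simp [h]
      rw [this, pos_perm]
      omega
    rw [← this, pos_perm, hp]
  · intro h
    have := S.pos_hi t
    exact ⟨_, _, h, by rw [← h, ← this]; rfl, S.perm_succ t⟩

/-- The half period. -/
abbrev half (_S : SimpleAllowableSequence n) : ℤ := (n.choose 2 : ℕ)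

theorem pos_add_half (S : SimpleAllowableSequence n) (t : ℤ) (x : Fin n) :
    S.pos (t + S.half) x + S.pos t x + 1 = n := by
  have h : S.pos (t + S.half) x = (Fin.rev ((S.perm t).symm x) : Fin n) := by
    unfold pos
    rw [S.perm_add t]
    congr 1
  have h2 := S.pos_lt t x
  rw [h, Fin.val_rev]
  unfold pos at *
  omega

theorem lo_add_half (S : SimpleAllowableSequence n) (t : ℤ) : S.lo (t + S.half) = S.hi t := by
  have h1 := S.pos_add_half t (S.lo (t + S.half))
  have h2 := S.pos_add_half (t + 1) (S.lo (t + S.half))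
  have h3 := S.eq_lo_iff.1 (Eq.refl (S.lo (t + S.half)))
  rw [add_right_comm t 1] at h2
  rw [eq_hi_iff]
  omega

theorem hi_add_half (S : SimpleAllowableSequence n) (t : ℤ) : S.hi (t + S.half) = S.lo t := by
  have h1 := S.pos_add_half t (S.hi (t + S.half))
  have h2 := S.pos_add_half (t + 1) (S.hi (t + S.half))
  have h3 := S.eq_hi_iff.1 (Eq.refl (S.hi (t + S.half)))
  rw [add_right_comm t 1] at h2
  rw [eq_lo_iff]
  omega

theorem pos_add_period (S : SimpleAllowableSequence n) (t : ℤ) (x : Fin n) :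
    S.pos (t + 2 * S.half) x = S.pos t x := by
  have h1 := S.pos_add_half t x
  have h2 := S.pos_add_half (t + S.half) x
  rw [add_assoc t, ← two_mul] at h2
  omega

theorem lo_add_period (S : SimpleAllowableSequence n) (t : ℤ) :
    S.lo (t + 2 * S.half) = S.lo t := by
  rw [two_mul, ← add_assoc, lo_add_half, hi_add_half]

theorem hi_add_period (S : SimpleAllowableSequence n) (t : ℤ) :
    S.hi (t + 2 * S.half) = S.hi t := by
  rw [two_mul, ← add_assoc, hi_add_half, lo_add_half]

/-! ### Each pair of labels is swapped exactly once in a halfperiod. -/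

/-- The order of two labels changes only when they are transposed. -/
theorem pos_lt_succ_iff (S : SimpleAllowableSequence n) {t : ℤ} {x y : Fin n} (hxy : x ≠ y)
    (h : s(S.lo t, S.hi t) ≠ s(x, y)) :
    S.pos (t + 1) x < S.pos (t + 1) y ↔ S.pos t x < S.pos t y := by
  have h1 := S.pos_succ_lo t
  have h2 := S.pos_succ_hi t
  have h3 := S.pos_hi t
  have hne : S.pos t x ≠ S.pos t y := fun e => hxy (S.pos_inj.1 e)
  have hxl : x ≠ S.lo t → S.pos t x ≠ S.pos t (S.lo t) := fun e e' => e (S.pos_inj.1 e')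
  have hxh : x ≠ S.hi t → S.pos t x ≠ S.pos t (S.hi t) := fun e e' => e (S.pos_inj.1 e')
  have hyl : y ≠ S.lo t → S.pos t y ≠ S.pos t (S.lo t) := fun e e' => e (S.pos_inj.1 e')
  have hyh : y ≠ S.hi t → S.pos t y ≠ S.pos t (S.hi t) := fun e e' => e (S.pos_inj.1 e')
  by_cases xl : x = S.lo t
  · have yl : y ≠ S.lo t := fun e => hxy (xl.trans e.symm)
    have yh : y ≠ S.hi t := by rintro rfl; exact h (by rw [xl])
    have h4 := S.pos_succ_of_ne yl yh
    have := hyl yl; have := hyh yh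
    subst xl; omega
  by_cases xh : x = S.hi t
  · have yh : y ≠ S.hi t := fun e => hxy (xh.trans e.symm)
    have yl : y ≠ S.lo t := by rintro rfl; exact h (by rw [xh, Sym2.eq_swap])
    have h4 := S.pos_succ_of_ne yl yh
    have := hyl yl; have := hyh yh
    subst xh; omega
  have h4 := S.pos_succ_of_ne xl xh
  have := hxl xl; have := hxh xh
  by_cases yl : y = S.lo t
  · subst yl; omega
  by_cases yh : y = S.hi t
  · subst yh; omega
  rw [h4, S.pos_succ_of_ne yl yh]

theorem pos_lt_iff_of_forall_ne (S : SimpleAllowableSequence n) {x y : Fin n} (hxy : x ≠ y)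
    {t t' : ℤ} (htt : t ≤ t') (h : ∀ s, t ≤ s → s < t' → s(S.lo s, S.hi s) ≠ s(x, y)) :
    S.pos t' x < S.pos t' y ↔ S.pos t x < S.pos t y := by
  induction t', htt using Int.leInduction with
  | base => rfl
  | succ r hr ih =>
    rw [S.pos_lt_succ_iff hxy (h r hr (by omega))]
    exact ih fun s h1 h2 => h s h1 (by omega)

theorem exists_swap_of_pos_lt (S : SimpleAllowableSequence n) {x y : Fin n} {t t' : ℤ}
    (htt : t ≤ t') (h1 : S.pos t x < S.pos t y) (h2 : S.pos t' y < S.pos t' x) :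
    ∃ s, t ≤ s ∧ s < t' ∧ s(S.lo s, S.hi s) = s(x, y) := by
  by_contra! h
  have hxy : x ≠ y := by rintro rfl; omega
  have := S.pos_lt_iff_of_forall_ne hxy htt h
  omega

theorem pos_lt_add_half_iff (S : SimpleAllowableSequence n) {x y : Fin n} (t : ℤ) :
    S.pos (t + S.half) x < S.pos (t + S.half) y ↔ S.pos t y < S.pos t x := by
  have h1 := S.pos_add_half t x
  have h2 := S.pos_add_half t y
  omega

theorem exists_swap (S : SimpleAllowableSequence n) {x y : Fin n} (hxy : x ≠ y) (i : ℤ) :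
    ∃ s, i ≤ s ∧ s < i + S.half ∧ s(S.lo s, S.hi s) = s(x, y) := by
  have hN : (0 : ℤ) ≤ S.half := by positivity
  rcases lt_trichotomy (S.pos i x) (S.pos i y) with h | h | h
  · exact S.exists_swap_of_pos_lt (by omega) h ((S.pos_lt_add_half_iff i).2 h)
  · exact absurd (S.pos_inj.1 h) hxy
  · rw [Sym2.eq_swap]
    exact S.exists_swap_of_pos_lt (by omega) h ((S.pos_lt_add_half_iff i).2 h)

/-- In a halfperiod each pair of labels is transposed only once. -/
theorem swap_injOn (S : SimpleAllowableSequence n) (i : ℤ) :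
    Set.InjOn (fun t => s(S.lo t, S.hi t)) (Finset.Ico i (i + S.half) : Finset ℤ) := by
  classical
  -- Every pair is reversed within the halfperiod, and there are as many times as pairs, so
  -- surjectivity forces injectivity.
  refine Finset.injOn_of_surjOn_of_card_le
    (t := Finset.univ.filter fun e : Sym2 (Fin n) => ¬ e.IsDiag) _ ?_ ?_ ?_
  · intro t _
    simpa using S.lo_ne_hi t
  · intro e he
    induction e using Sym2.ind with
    | _ x y =>
      obtain ⟨s, h1, h2, h3⟩ := S.exists_swap (x := x) (y := y) (by simpa using he) i
      exact ⟨s, by simp [h1, h2], h3⟩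
  · have := Sym2.card_subtype_not_diag (α := Fin n)
    rw [Fintype.card_subtype] at this
    simp [this]

theorem eq_of_swap_eq (S : SimpleAllowableSequence n) {t t' : ℤ} (h1 : t ≤ t')
    (h2 : t' < t + S.half) (h : s(S.lo t, S.hi t) = s(S.lo t', S.hi t')) : t = t' :=
  S.swap_injOn t (Finset.mem_coe.2 (Finset.mem_Ico.2 ⟨le_rfl, by omega⟩))
    (Finset.mem_coe.2 (Finset.mem_Ico.2 ⟨h1, h2⟩)) h

/-- Within a halfperiod, a label that has overtaken another one stays ahead of it. -/
theorem pos_lt_of_pos_lt_of_pos_lt (S : SimpleAllowableSequence n) {x z : Fin n} {t₀ t t' : ℤ}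
    (h0 : S.pos t₀ x < S.pos t₀ z) (h1 : t₀ ≤ t) (h : S.pos t z < S.pos t x) (h2 : t ≤ t')
    (h3 : t' ≤ t₀ + S.half) : S.pos t' z < S.pos t' x := by
  by_contra h4
  have hne : S.pos t' z ≠ S.pos t' x := by
    intro e; rw [S.pos_inj] at e; subst e; omega
  obtain ⟨s, hs1, hs2, hs3⟩ := S.exists_swap_of_pos_lt h1 h0 h
  obtain ⟨s', hs1', hs2', hs3'⟩ := S.exists_swap_of_pos_lt h2 h (by omega)
  -- Falling behind again would be a second swap of the same pair within the halfperiod.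
  have := S.eq_of_swap_eq (t := s) (t' := s') (by omega) (by omega)
    (by rw [hs3, hs3', Sym2.eq_swap])
  omega

/-- Shifting the window by one trades `i` for `i + L`. This allows counts over a period to start at
whatever time is convenient. -/
theorem card_filter_Ico_of_periodic {P : ℤ → Prop} [DecidablePred P] {L : ℤ} (hL : 0 ≤ L)
    (hP : ∀ t, P (t + L) ↔ P t) (i j : ℤ) :
    ((Finset.Ico i (i + L)).filter P).card = ((Finset.Ico j (j + L)).filter P).card := by
  have key : ∀ i, ((Finset.Ico (i + 1) (i + 1 + L)).filter P).card =
      ((Finset.Ico i (i + L)).filter P).card := by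
    intro i
    rcases hL.eq_or_lt with h0 | h0
    · simp [← h0]
    · have e1 : Finset.Ico i (i + L) = insert i (Finset.Ico (i + 1) (i + L)) := by
        ext x; simp only [Finset.mem_Ico, Finset.mem_insert]; omega
      have e2 : Finset.Ico (i + 1) (i + 1 + L) =
          insert (i + L) (Finset.Ico (i + 1) (i + L)) := by
        ext x; simp only [Finset.mem_Ico, Finset.mem_insert]; omega
      rw [e1, e2, Finset.filter_insert, Finset.filter_insert]
      by_cases h : P i
      · rw [if_pos h, if_pos ((hP i).2 h), Finset.card_insert_of_notMem (by simp),
          Finset.card_insert_of_notMem (by simp)]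
      · rw [if_neg h, if_neg (fun h' => h ((hP i).1 h'))]
  have key0 : ∀ i, ((Finset.Ico i (i + L)).filter P).card =
      ((Finset.Ico 0 (0 + L)).filter P).card := by
    intro i
    induction i using Int.induction_on with
    | zero => rfl
    | succ i ih => rw [key, ih]
    | pred i ih => rw [← ih, ← key, sub_add_cancel]
  rw [key0 i, key0 j]

/-! ### Ranks within a set of labels. -/

/-- The number of labels of `W` before `x` at time `t`. -/
def rank (S : SimpleAllowableSequence n) (W : Finset (Fin n)) (t : ℤ) (x : Fin n) : ℕ :=
  (W.filter fun z => S.pos t z < S.pos t x).card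

theorem rank_lt_rank (S : SimpleAllowableSequence n) {W : Finset (Fin n)} {t : ℤ} {x y : Fin n}
    (hx : x ∈ W) (h : S.pos t x < S.pos t y) : S.rank W t x < S.rank W t y := by
  refine Finset.card_lt_card ⟨fun z => ?_, fun hh => ?_⟩
  · simp only [Finset.mem_filter]
    rintro ⟨h1, h2⟩
    exact ⟨h1, by omega⟩
  · have := hh (Finset.mem_filter.2 ⟨hx, h⟩)
    simp at this

theorem rank_injOn (S : SimpleAllowableSequence n) (W : Finset (Fin n)) (t : ℤ) :
    Set.InjOn (S.rank W t) W := by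
  intro x hx y hy h
  by_contra hne
  rcases lt_or_gt_of_ne (fun e => hne (S.pos_inj.1 e) : S.pos t x ≠ S.pos t y) with h1 | h1
  · exact absurd h (S.rank_lt_rank hx h1).ne
  · exact absurd h (S.rank_lt_rank hy h1).ne'

theorem rank_lt_card (S : SimpleAllowableSequence n) {W : Finset (Fin n)} {t : ℤ} {x : Fin n}
    (hx : x ∈ W) : S.rank W t x < W.card := by
  refine Finset.card_lt_card ⟨Finset.filter_subset _ _, fun hh => ?_⟩
  have := hh hx
  simp at this

theorem rank_univ (S : SimpleAllowableSequence n) (t : ℤ) (x : Fin n) :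
    S.rank Finset.univ t x = S.pos t x := by
  have : (Finset.univ.filter fun z => S.pos t z < S.pos t x).card =
      (Finset.range (S.pos t x)).card := by
    refine Finset.card_bij (fun z _ => S.pos t z) ?_ ?_ ?_
    · intro z hz; simpa using hz
    · intro z _ z' _ h; exact S.pos_inj.1 h
    · intro p hp
      have hp : p < S.pos t x := by simpa using hp
      have hpn : p < n := hp.trans (S.pos_lt t x)
      exact ⟨S.perm t ⟨p, hpn⟩, by simp [pos_perm, hp], by simp [pos_perm]⟩
  simpa [rank] using this

theorem exists_rank_eq_zero (S : SimpleAllowableSequence n) {W : Finset (Fin n)}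
    (hW : W.Nonempty) (t : ℤ) : ∃ x ∈ W, S.rank W t x = 0 := by
  obtain ⟨x, hx, h⟩ := W.exists_min_image (S.pos t) hW
  refine ⟨x, hx, ?_⟩
  rw [rank, Finset.card_eq_zero, Finset.filter_eq_empty_iff]
  intro z hz
  have := h z hz
  omega

theorem image_rank (S : SimpleAllowableSequence n) (W : Finset (Fin n)) (t : ℤ) :
    W.image (S.rank W t) = Finset.range W.card := by
  refine Finset.eq_of_subset_of_card_le ?_ ?_
  · intro r hr
    obtain ⟨x, hx, rfl⟩ := Finset.mem_image.1 hr
    exact Finset.mem_range.2 (S.rank_lt_card hx)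
  · rw [Finset.card_image_of_injOn (S.rank_injOn W t), Finset.card_range]

theorem rank_add_half (S : SimpleAllowableSequence n) {W : Finset (Fin n)} {t : ℤ} {x : Fin n}
    (hx : x ∈ W) : S.rank W (t + S.half) x + S.rank W t x + 1 = W.card := by
  have h1 : (W.filter fun z => S.pos (t + S.half) z < S.pos (t + S.half) x) =
      W.filter fun z => S.pos t x < S.pos t z := by
    refine Finset.filter_congr fun z _ => ?_
    exact S.pos_lt_add_half_iff t
  have h2 : (W.erase x).card = (W.filter fun z => S.pos t x < S.pos t z).card +
      (W.filter fun z => S.pos t z < S.pos t x).card := by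
    rw [← Finset.card_union_of_disjoint]
    · congr 1
      ext z
      simp only [Finset.mem_erase, Finset.mem_union, Finset.mem_filter]
      have : z ≠ x ↔ S.pos t x ≠ S.pos t z := by rw [ne_comm, not_iff_not, S.pos_inj]
      constructor
      · rintro ⟨h, hz⟩
        have := this.1 h
        rcases lt_or_gt_of_ne this with h | h
        · exact Or.inl ⟨hz, h⟩
        · exact Or.inr ⟨hz, h⟩
      · rintro (⟨hz, h⟩ | ⟨hz, h⟩)
        · exact ⟨this.2 (by omega), hz⟩
        · exact ⟨this.2 (by omega), hz⟩
    · rw [Finset.disjoint_filter]; intro z _ _; omega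
  have h3 := Finset.card_erase_add_one hx
  unfold rank
  rw [h1]
  omega

theorem rank_add_period (S : SimpleAllowableSequence n) (W : Finset (Fin n)) (t : ℤ) (x : Fin n) :
    S.rank W (t + 2 * S.half) x = S.rank W t x := by
  simp [rank, pos_add_period]

theorem rank_hi (S : SimpleAllowableSequence n) {W : Finset (Fin n)} {t : ℤ}
    (h : S.lo t ∈ W) : S.rank W t (S.hi t) = S.rank W t (S.lo t) + 1 := by
  unfold rank
  rw [← Finset.card_insert_of_notMem (a := S.lo t) (by simp)]
  congr 1
  ext z
  simp only [Finset.mem_filter, Finset.mem_insert, S.pos_hi t]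
  constructor
  · rintro ⟨h1, h2⟩
    by_cases hz : z = S.lo t
    · exact Or.inl hz
    · exact Or.inr ⟨h1, by have : S.pos t z ≠ S.pos t (S.lo t) := fun e => hz (S.pos_inj.1 e); omega⟩
  · rintro (rfl | ⟨h1, h2⟩)
    · exact ⟨h, by omega⟩
    · exact ⟨h1, by omega⟩

theorem rank_succ_eq (S : SimpleAllowableSequence n) {W : Finset (Fin n)} {t : ℤ} {x : Fin n}
    (h : ∀ z ∈ W, s(S.lo t, S.hi t) ≠ s(z, x)) : S.rank W (t + 1) x = S.rank W t x := by
  unfold rank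
  congr 1
  refine Finset.filter_congr fun z hz => ?_
  by_cases hzx : z = x
  · subst hzx; simp
  · exact S.pos_lt_succ_iff hzx (h z hz)

theorem rank_succ_lo (S : SimpleAllowableSequence n) {W : Finset (Fin n)} {t : ℤ}
    (h : S.hi t ∈ W) : S.rank W (t + 1) (S.lo t) = S.rank W t (S.lo t) + 1 := by
  unfold rank
  rw [← Finset.card_insert_of_notMem (a := S.hi t) (by simp [S.pos_hi])]
  congr 1
  ext z
  simp only [Finset.mem_filter, Finset.mem_insert]
  have a1 := S.pos_succ_lo t
  have a2 := S.pos_succ_hi t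
  by_cases hz : z = S.hi t
  · subst hz; simp only [h, true_and, true_or, iff_true]; omega
  · by_cases hz' : z = S.lo t
    · subst hz'; simp [hz]
    · rw [S.pos_lt_succ_iff hz' (by
        intro e
        rw [Sym2.eq_iff] at e
        rcases e with e | e
        · exact hz' e.1.symm
        · exact hz e.2.symm)]
      simp [hz]

theorem rank_succ_hi (S : SimpleAllowableSequence n) {W : Finset (Fin n)} {t : ℤ}
    (h : S.lo t ∈ W) : S.rank W (t + 1) (S.hi t) + 1 = S.rank W t (S.hi t) := by
  rw [S.rank_hi h]
  congr 1
  unfold rank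
  congr 1
  refine Finset.filter_congr fun z hz => ?_
  have a1 := S.pos_succ_lo t
  have a2 := S.pos_succ_hi t
  have a3 := S.pos_hi t
  rw [a2]
  by_cases hz : z = S.hi t
  · subst hz; omega
  · by_cases hz' : z = S.lo t
    · subst hz'; omega
    · rw [S.pos_succ_of_ne hz' hz]

/-- A rank changes by at most one per step, and only in a swap with a label of `W`. The crossing
lemmas `exists_rank_up` and `exists_rank_down` are discrete intermediate value arguments built on
this. -/
theorem rank_succ_cases (S : SimpleAllowableSequence n) (W : Finset (Fin n)) (t : ℤ) (x : Fin n) :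
    S.rank W (t + 1) x = S.rank W t x ∨
    (x = S.lo t ∧ S.hi t ∈ W ∧ S.rank W (t + 1) x = S.rank W t x + 1) ∨
    (x = S.hi t ∧ S.lo t ∈ W ∧ S.rank W (t + 1) x + 1 = S.rank W t x) := by
  by_cases h : ∀ z ∈ W, s(S.lo t, S.hi t) ≠ s(z, x)
  · exact Or.inl (S.rank_succ_eq h)
  · push Not at h
    obtain ⟨z, hz, h⟩ := h
    rw [Sym2.eq_iff] at h
    rcases h with ⟨rfl, rfl⟩ | ⟨rfl, rfl⟩
    · exact Or.inr (Or.inr ⟨rfl, hz, S.rank_succ_hi hz⟩)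
    · exact Or.inr (Or.inl ⟨rfl, hz, S.rank_succ_lo hz⟩)

theorem lo_hi_of_rank_lt (S : SimpleAllowableSequence n) {W : Finset (Fin n)} {t : ℤ} {x : Fin n}
    (h : S.rank W t x < S.rank W (t + 1) x) :
    x = S.lo t ∧ S.hi t ∈ W ∧ S.rank W (t + 1) x = S.rank W t x + 1 := by
  rcases S.rank_succ_cases W t x with h1 | h1 | h1
  · omega
  · exact h1
  · omega

theorem lo_hi_of_rank_gt (S : SimpleAllowableSequence n) {W : Finset (Fin n)} {t : ℤ} {x : Fin n}
    (h : S.rank W (t + 1) x < S.rank W t x) :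
    x = S.hi t ∧ S.lo t ∈ W ∧ S.rank W (t + 1) x + 1 = S.rank W t x := by
  rcases S.rank_succ_cases W t x with h1 | h1 | h1
  · omega
  · omega
  · exact h1

/-- A predicate that holds at `i` and fails at `j` has a last moment before it first fails. -/
theorem exists_last {P : ℤ → Prop} {i j : ℤ} (hij : i ≤ j) (hi : P i) (hj : ¬ P j) :
    ∃ t, i ≤ t ∧ t < j ∧ P t ∧ ¬ P (t + 1) := by
  by_contra! h
  have : ∀ t, i ≤ t → t ≤ j → P t := by
    intro t ht
    induction t, ht using Int.leInduction with
    | base => exact fun _ => hi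
    | succ r hr ih => exact fun h1 => h r hr (by omega) (ih (by omega))
  exact hj (this j hij le_rfl)

theorem exists_rank_up (S : SimpleAllowableSequence n) {W : Finset (Fin n)} {i j : ℤ} {x : Fin n}
    {r : ℕ} (hij : i ≤ j) (h1 : S.rank W i x ≤ r) (h2 : r < S.rank W j x) :
    ∃ t, i ≤ t ∧ t < j ∧ x = S.lo t ∧ S.hi t ∈ W ∧ S.rank W t x = r := by
  obtain ⟨t, a, b, c, d⟩ := exists_last (P := fun t => S.rank W t x ≤ r) hij h1 (by omega)
  have := S.lo_hi_of_rank_lt (W := W) (t := t) (x := x) (by omega)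
  exact ⟨t, a, b, this.1, this.2.1, by omega⟩

theorem exists_rank_down (S : SimpleAllowableSequence n) {W : Finset (Fin n)} {i j : ℤ}
    {x : Fin n} {r : ℕ} (hij : i ≤ j) (h1 : r < S.rank W i x) (h2 : S.rank W j x ≤ r) :
    ∃ t, i ≤ t ∧ t < j ∧ x = S.hi t ∧ S.lo t ∈ W ∧ S.rank W t x = r + 1 := by
  obtain ⟨t, a, b, c, d⟩ := exists_last (P := fun t => r < S.rank W t x) hij h1 (by omega)
  have := S.lo_hi_of_rank_gt (W := W) (t := t) (x := x) (by omega)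
  exact ⟨t, a, b, this.1, this.2.1, by omega⟩

/-! ### Shallow transpositions. -/

/-- At time `t` the `j`-th and the `(j + 1)`-st labels of `W` are transposed. -/
def IsEvent (S : SimpleAllowableSequence n) (W : Finset (Fin n)) (j : ℕ) (t : ℤ) : Prop :=
  S.lo t ∈ W ∧ S.hi t ∈ W ∧ S.rank W t (S.lo t) + 1 = j

/-- At time `t` two labels of `W` are transposed and fewer than `k` labels of `W` are to the left
of them. -/
def IsShallow (S : SimpleAllowableSequence n) (W : Finset (Fin n)) (k : ℕ) (t : ℤ) : Prop :=
  S.lo t ∈ W ∧ S.hi t ∈ W ∧ S.rank W t (S.lo t) < k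

theorem isShallow_add_period (S : SimpleAllowableSequence n) (W : Finset (Fin n)) (k : ℕ) (t : ℤ) :
    S.IsShallow W k (t + 2 * S.half) ↔ S.IsShallow W k t := by
  simp [IsShallow, lo_add_period, hi_add_period, rank_add_period]

open Classical in
/-- The number of shallow transpositions of pairs from `W` in a period. -/
noncomputable def numShallow (S : SimpleAllowableSequence n) (W : Finset (Fin n)) (k : ℕ) : ℕ :=
  ((Finset.Ico (0 : ℤ) (0 + 2 * S.half)).filter fun t => S.IsShallow W k t).card

open Classical in
theorem numShallow_eq (S : SimpleAllowableSequence n) (W : Finset (Fin n)) (k : ℕ) (i : ℤ) :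
    S.numShallow W k =
      ((Finset.Ico i (i + 2 * S.half)).filter fun t => S.IsShallow W k t).card :=
  card_filter_Ico_of_periodic (by positivity) (S.isShallow_add_period W k) _ _

/-- The first `j` labels of `W` at time `t`. -/
def first (S : SimpleAllowableSequence n) (W : Finset (Fin n)) (j : ℕ) (t : ℤ) : Finset (Fin n) :=
  W.filter fun x => S.rank W t x < j

theorem first_subset (S : SimpleAllowableSequence n) (W : Finset (Fin n)) (j : ℕ) (t : ℤ) :
    S.first W j t ⊆ W := Finset.filter_subset _ _

theorem card_first (S : SimpleAllowableSequence n) {W : Finset (Fin n)} {j : ℕ} (hj : j ≤ W.card)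
    (t : ℤ) : (S.first W j t).card = j := by
  have h : (S.first W j t).image (S.rank W t) = Finset.range j := by
    ext r
    simp only [first, Finset.mem_image, Finset.mem_filter, Finset.mem_range]
    constructor
    · rintro ⟨x, ⟨_, h⟩, rfl⟩; exact h
    · intro hr
      have : r ∈ W.image (S.rank W t) := by
        rw [S.image_rank]; exact Finset.mem_range.2 (by omega)
      obtain ⟨x, hx, rfl⟩ := Finset.mem_image.1 this
      exact ⟨x, ⟨hx, hr⟩, rfl⟩
  have hinj : Set.InjOn (S.rank W t) (S.first W j t) :=
    (S.rank_injOn W t).mono (Finset.filter_subset _ _)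
  rw [← Finset.card_image_of_injOn hinj, h,
    Finset.card_range]

theorem disjoint_first_add_half (S : SimpleAllowableSequence n) {W : Finset (Fin n)} {j : ℕ}
    (hj : 2 * j ≤ W.card) (t : ℤ) : Disjoint (S.first W j t) (S.first W j (t + S.half)) := by
  unfold first
  rw [Finset.disjoint_filter]
  intro x hx h1 h2
  have := S.rank_add_half (t := t) hx
  omega

open Classical in
/-- The set of the first `j` labels of `W` gains at most one label at each exchange at its end. -/
theorem card_first_sdiff_le (S : SimpleAllowableSequence n) (W : Finset (Fin n)) (j : ℕ) {s t : ℤ}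
    (hst : s ≤ t) : (S.first W j t \ S.first W j s).card ≤
      ((Finset.Ico s t).filter fun r => S.IsEvent W j r).card := by
  have hsub : S.first W j t \ S.first W j s ⊆
      ((Finset.Ico s t).filter fun r => S.IsEvent W j r).image S.hi := by
    intro x hx
    simp only [first, Finset.mem_sdiff, Finset.mem_filter] at hx
    obtain ⟨⟨hxW, h1⟩, h2⟩ := hx
    have h3 : j ≤ S.rank W s x := by
      by_contra h; exact h2 ⟨hxW, by omega⟩
    obtain ⟨r, a, b, c, d, e⟩ := S.exists_rank_down (r := j - 1) hst
      (by omega : j - 1 < S.rank W s x) (by omega)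
    refine Finset.mem_image.2 ⟨r, ?_, c.symm⟩
    simp only [Finset.mem_filter, Finset.mem_Ico]
    have := S.rank_hi d
    rw [c] at e
    exact ⟨⟨a, b⟩, d, c ▸ hxW, by omega⟩
  exact (Finset.card_le_card hsub).trans Finset.card_image_le

open Classical in
/-- A label of `W` that is the first one at some time takes part in at least `2 k` shallow
transpositions of each period. -/
theorem two_mul_le_card_shallow (S : SimpleAllowableSequence n) {W : Finset (Fin n)} {k : ℕ}
    (hk : k < W.card) {x : Fin n} (hx : x ∈ W) {t₀ : ℤ} (h0 : S.rank W t₀ x = 0) (i : ℤ) :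
    2 * k ≤ ((Finset.Ico i (i + 2 * S.half)).filter fun t =>
      S.IsShallow W k t ∧ (x = S.lo t ∨ x = S.hi t)).card := by
  have hN : 0 ≤ S.half := by positivity
  -- Start the period at `t₀`, where `x` is first. In one halfperiod it climbs through all ranks and
  -- in the next it descends again, crossing each of the `k` lowest levels once in each direction at
  -- least.
  rw [card_filter_Ico_of_periodic (by positivity) (fun t => by
    rw [isShallow_add_period, lo_add_period, hi_add_period]) i t₀]
  have hlast := S.rank_add_half (t := t₀) hx
  have hback := S.rank_add_period W t₀ x
  have h1 : k ≤ ((Finset.Ico t₀ (t₀ + S.half)).filter fun t =>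
      S.IsShallow W k t ∧ x = S.lo t).card := by
    have hsub : Finset.range k ⊆ ((Finset.Ico t₀ (t₀ + S.half)).filter fun t =>
        S.IsShallow W k t ∧ x = S.lo t).image (fun t => S.rank W t x) := by
      intro r hr
      rw [Finset.mem_range] at hr
      obtain ⟨t, a, b, c, d, e⟩ := S.exists_rank_up (W := W) (x := x) (r := r)
        (by omega : t₀ ≤ t₀ + S.half) (by omega) (by omega)
      refine Finset.mem_image.2 ⟨t, ?_, e⟩
      simp only [Finset.mem_filter, Finset.mem_Ico]
      refine ⟨⟨a, b⟩, ⟨c ▸ hx, d, ?_⟩, c⟩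
      rw [← c, e]; exact hr
    simpa using (Finset.card_le_card hsub).trans Finset.card_image_le
  have h2 : k ≤ ((Finset.Ico (t₀ + S.half) (t₀ + 2 * S.half)).filter fun t =>
      S.IsShallow W k t ∧ x = S.hi t).card := by
    have hsub : Finset.range k ⊆ ((Finset.Ico (t₀ + S.half) (t₀ + 2 * S.half)).filter fun t =>
        S.IsShallow W k t ∧ x = S.hi t).image (fun t => S.rank W t x - 1) := by
      intro r hr
      rw [Finset.mem_range] at hr
      obtain ⟨t, a, b, c, d, e⟩ := S.exists_rank_down (W := W) (x := x) (r := r)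
        (by omega : t₀ + S.half ≤ t₀ + 2 * S.half) (by omega) (by omega)
      refine Finset.mem_image.2 ⟨t, ?_, by simp [e]⟩
      simp only [Finset.mem_filter, Finset.mem_Ico]
      refine ⟨⟨a, b⟩, ⟨d, c ▸ hx, ?_⟩, c⟩
      have := S.rank_hi d
      rw [c] at e
      omega
    simpa using (Finset.card_le_card hsub).trans Finset.card_image_le
  calc 2 * k ≤ _ := by rw [two_mul]; exact add_le_add h1 h2
    _ = _ := (Finset.card_union_of_disjoint (by
      rw [Finset.disjoint_left]
      intro t ht ht'
      simp only [Finset.mem_filter, Finset.mem_Ico] at ht ht'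
      omega)).symm
    _ ≤ _ := Finset.card_le_card (by
      intro t
      simp only [Finset.mem_union, Finset.mem_filter, Finset.mem_Ico]
      rintro (⟨h, h', h''⟩ | ⟨h, h', h''⟩)
      · exact ⟨by omega, h', Or.inl h''⟩
      · exact ⟨by omega, h', Or.inr h''⟩)

open Classical in
/-- A pair of labels takes part in at most one shallow transposition of each period. -/
theorem card_shallow_pair_le_one (S : SimpleAllowableSequence n) {W : Finset (Fin n)} {k : ℕ}
    (hk : 2 * k < W.card) (x y : Fin n) (i : ℤ) :
    ((Finset.Ico i (i + 2 * S.half)).filter fun t =>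
      S.IsShallow W k t ∧ s(S.lo t, S.hi t) = s(x, y)).card ≤ 1 := by
  rw [Finset.card_le_one]
  have key : ∀ t t', i ≤ t → t ≤ t' → t' < i + 2 * S.half → S.IsShallow W k t →
      S.IsShallow W k t' → s(S.lo t, S.hi t) = s(S.lo t', S.hi t') → t = t' := by
    intro t t' h1 h2 h3 h4 h5 h6
    by_cases h7 : t' < t + S.half
    · exact S.eq_of_swap_eq h2 h7 h6
    -- A repetition within the period occurs exactly a halfperiod later, where the rank r of the
    -- left label has become |W| - 2 - r. Both cannot be below `k`, since 2k < |W|.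
    · exfalso
      have h8 := S.eq_of_swap_eq (t := t + S.half) (t' := t') (by omega) (by omega)
        (by rw [lo_add_half, hi_add_half, Sym2.eq_swap]; exact h6)
      subst h8
      have h9 := S.rank_add_half (t := t) h4.2.1
      have h10 := S.rank_hi h4.1
      have h11 := h5.2.2
      have h12 := h4.2.2
      rw [lo_add_half] at h11
      omega
  intro t ht t' ht'
  simp only [Finset.mem_filter, Finset.mem_Ico] at ht ht'
  rcases le_total t t' with h | h
  · exact key t t' ht.1.1 h ht'.1.2 ht.2.1 ht'.2.1 (ht.2.2.trans ht'.2.2.symm)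
  · exact (key t' t ht'.1.1 h ht.1.2 ht'.2.1 ht.2.1 (ht'.2.2.trans ht.2.2.symm)).symm

theorem card_union_three_ge {α : Type*} [DecidableEq α] (A B C : Finset α) :
    A.card + B.card + C.card ≤
      (A ∪ B ∪ C).card + (A ∩ B).card + (A ∩ C).card + (B ∩ C).card := by
  have h1 := Finset.card_union_add_card_inter A B
  have h2 := Finset.card_union_add_card_inter (A ∪ B) C
  have h3 : ((A ∪ B) ∩ C).card ≤ (A ∩ C).card + (B ∩ C).card := by
    rw [Finset.union_inter_distrib_right]
    exact Finset.card_union_le _ _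
  omega

open Classical in
/-- Three labels of `W` each of which is the first one at some time take part in at least `6 k - 3`
shallow transpositions. -/
theorem card_shallow_three_ge (S : SimpleAllowableSequence n) {W : Finset (Fin n)} {k : ℕ}
    (hk : 2 * k < W.card) {a b c : Fin n} (hab : a ≠ b) (hac : a ≠ c) (hbc : b ≠ c)
    (ha : a ∈ W) (hb : b ∈ W) (hc : c ∈ W) (ha0 : ∃ t, S.rank W t a = 0)
    (hb0 : ∃ t, S.rank W t b = 0) (hc0 : ∃ t, S.rank W t c = 0) (i : ℤ) :
    6 * k ≤ ((Finset.Ico i (i + 2 * S.half)).filter fun t =>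
      S.IsShallow W k t ∧ ¬ (S.lo t ∈ W \ {a, b, c} ∧ S.hi t ∈ W \ {a, b, c})).card + 3 := by
  obtain ⟨ta, ha0⟩ := ha0
  obtain ⟨tb, hb0⟩ := hb0
  obtain ⟨tc, hc0⟩ := hc0
  set F : Fin n → Finset ℤ := fun x => (Finset.Ico i (i + 2 * S.half)).filter fun t =>
      S.IsShallow W k t ∧ (x = S.lo t ∨ x = S.hi t) with hF
  have h1 : 2 * k ≤ (F a).card := S.two_mul_le_card_shallow (by omega) ha ha0 i
  have h2 : 2 * k ≤ (F b).card := S.two_mul_le_card_shallow (by omega) hb hb0 i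
  have h3 : 2 * k ≤ (F c).card := S.two_mul_le_card_shallow (by omega) hc hc0 i
  -- The three pairs among `a`, `b`, `c` are the only source of double counting, which costs at most
  -- 3 in total.
  have hpair : ∀ x y, x ≠ y → (F x ∩ F y).card ≤ 1 := by
    intro x y hxy
    refine le_trans (Finset.card_le_card ?_) (S.card_shallow_pair_le_one hk x y i)
    intro t
    simp only [hF, Finset.mem_inter, Finset.mem_filter]
    rintro ⟨⟨h, h', h2⟩, -, -, h4⟩
    refine ⟨h, h', ?_⟩
    rw [Sym2.eq_iff]
    rcases h2 with rfl | rfl <;> rcases h4 with rfl | rfl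
    · exact absurd rfl hxy
    · exact Or.inl ⟨rfl, rfl⟩
    · exact Or.inr ⟨rfl, rfl⟩
    · exact absurd rfl hxy
  have h4 := card_union_three_ge (F a) (F b) (F c)
  have h5 := hpair a b hab
  have h6 := hpair a c hac
  have h7 := hpair b c hbc
  have h8 : (F a ∪ F b ∪ F c).card ≤ ((Finset.Ico i (i + 2 * S.half)).filter fun t =>
      S.IsShallow W k t ∧ ¬ (S.lo t ∈ W \ {a, b, c} ∧ S.hi t ∈ W \ {a, b, c})).card := by
    refine Finset.card_le_card fun t => ?_
    simp only [hF, Finset.mem_union, Finset.mem_filter, Finset.mem_sdiff, Finset.mem_insert,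
      Finset.mem_singleton]
    rintro ((⟨h, h', rfl | rfl⟩ | ⟨h, h', rfl | rfl⟩) | ⟨h, h', rfl | rfl⟩) <;>
      exact ⟨h, h', by simp⟩
  omega

/-! ### Three labels leaving the left end, and their removal. -/

/-- The label `x` is the first label of `W` at some time, it has at most `k` labels of `W` to its
left just before the time `τ`, and more than `k` during the halfperiod that begins at `τ`. -/
def IsExit (S : SimpleAllowableSequence n) (W : Finset (Fin n)) (k : ℕ) (x : Fin n) (τ : ℤ) :
    Prop :=
  x ∈ W ∧ (∃ t, S.rank W t x = 0) ∧ S.rank W (τ - 1) x ≤ k ∧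
    ∀ t, τ ≤ t → t < τ + S.half → k < S.rank W t x

/-- Starting from the first place, a label can only overtake during the next halfperiod, and what it
has overtaken stays behind it. So the set counted by its rank only grows. -/
theorem rank_le_rank_of_rank_eq_zero (S : SimpleAllowableSequence n) {W : Finset (Fin n)}
    {x : Fin n} {t₀ t t' : ℤ} (h0 : S.rank W t₀ x = 0) (h1 : t₀ ≤ t) (h2 : t ≤ t')
    (h3 : t' ≤ t₀ + S.half) : S.rank W t x ≤ S.rank W t' x := by
  refine Finset.card_le_card fun z => ?_
  simp only [Finset.mem_filter]
  rintro ⟨hz, h⟩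
  refine ⟨hz, S.pos_lt_of_pos_lt_of_pos_lt ?_ h1 h h2 h3⟩
  rw [rank, Finset.card_eq_zero, Finset.filter_eq_empty_iff] at h0
  have h4 : S.pos t₀ z ≠ S.pos t₀ x := by
    intro e; rw [S.pos_inj] at e; subst e; omega
  have := h0 hz
  omega

/-- The rank increases from 0 to |W| - 1, and the exit is where it passes `k`. Beyond `t₀ + S.half`
it is |W| - 1 minus its value a halfperiod earlier; as long as that value is at most `k`, the rank
is at least |W| - 1 - k ≥ k + 1. -/
theorem exists_isExit_of_rank_eq_zero (S : SimpleAllowableSequence n) {W : Finset (Fin n)} {k : ℕ}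
    (hk : 2 * k + 2 ≤ W.card) (hk1 : 1 ≤ k) {x : Fin n} (hx : x ∈ W) {t₀ : ℤ}
    (h0 : S.rank W t₀ x = 0) : ∃ τ, t₀ < τ ∧ τ < t₀ + S.half ∧ S.IsExit W k x τ := by
  have hN : 0 ≤ S.half := by positivity
  have hlast := S.rank_add_half (t := t₀) hx
  obtain ⟨t, a, b, c, d⟩ := exists_last (P := fun t => S.rank W t x ≤ k)
    (by omega : t₀ ≤ t₀ + S.half) (by omega) (by omega)
  have e := S.lo_hi_of_rank_lt (W := W) (t := t) (x := x) (by omega)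
  refine ⟨t + 1, by omega, ?_, hx, ⟨t₀, h0⟩, by simpa using c, ?_⟩
  · by_contra h
    have : t + 1 = t₀ + S.half := by omega
    rw [this] at e
    omega
  · intro s hs1 hs2
    by_cases hs : s ≤ t₀ + S.half
    · have := S.rank_le_rank_of_rank_eq_zero h0 (by omega) hs1 hs
      omega
    · have h4 := S.rank_le_rank_of_rank_eq_zero (t := s - S.half) (t' := t) h0 (by omega)
        (by omega) (by omega)
      have h5 := S.rank_add_half (t := s - S.half) hx
      rw [sub_add_cancel] at h5
      omega

theorem IsExit.ne_of_lt {S : SimpleAllowableSequence n} {W : Finset (Fin n)} {k : ℕ}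
    {x y : Fin n} {τ τ' : ℤ} (h : S.IsExit W k x τ) (h' : S.IsExit W k y τ') (h1 : τ < τ')
    (h2 : τ' ≤ τ + S.half) : x ≠ y := by
  rintro rfl
  have := h.2.2.2 (τ' - 1) (by omega) (by omega)
  have := h'.2.2.1
  omega

theorem IsExit.ne_of_lt_add_period {S : SimpleAllowableSequence n} {W : Finset (Fin n)} {k : ℕ}
    {x y : Fin n} {τ τ' : ℤ} (h : S.IsExit W k x τ) (h' : S.IsExit W k y τ')
    (h1 : τ + S.half ≤ τ') (h2 : τ' < τ + 2 * S.half) : x ≠ y := by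
  rintro rfl
  have h3 := h'.2.2.2 (τ - 1 + 2 * S.half) (by omega) (by omega)
  rw [rank_add_period] at h3
  have := h.2.2.1
  omega

/-- Take any exit α, the last exit β at most a halfperiod after it, and an exit γ less than a
halfperiod after β. Maximality of β puts γ beyond α + `S.half`. The three halfperiods in which these
labels are far from the left end then cover a whole period. -/
theorem exists_three_exits (S : SimpleAllowableSequence n) {W : Finset (Fin n)} {k : ℕ}
    (hk : 2 * k + 2 ≤ W.card) (hk1 : 1 ≤ k) :
    ∃ (a b c : Fin n) (α β γ : ℤ), S.IsExit W k a α ∧ S.IsExit W k b β ∧ S.IsExit W k c γ ∧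
      a ≠ b ∧ a ≠ c ∧ b ≠ c ∧ α + S.half ≤ γ ∧ γ ≤ β + S.half ∧ β ≤ α + S.half := by
  have hW : W.Nonempty := by rw [← Finset.card_pos]; omega
  have next : ∀ t, ∃ x τ, t < τ ∧ τ < t + S.half ∧ S.IsExit W k x τ := by
    intro t
    obtain ⟨x, hx, h0⟩ := S.exists_rank_eq_zero hW t
    obtain ⟨τ, h⟩ := S.exists_isExit_of_rank_eq_zero hk hk1 hx h0
    exact ⟨x, τ, h⟩
  obtain ⟨a, α, -, -, ha⟩ := next 0
  obtain ⟨β, ⟨hβ1, hβ2, b, hb⟩, hmax⟩ := Int.exists_greatest_of_bdd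
    (P := fun τ => α < τ ∧ τ ≤ α + S.half ∧ ∃ x, S.IsExit W k x τ)
    ⟨α + S.half, fun z hz => hz.2.1⟩ (by
      obtain ⟨x, τ, h1, h2, h3⟩ := next α
      exact ⟨τ, h1, h2.le, x, h3⟩)
  obtain ⟨c, γ, hγ1, hγ2, hc⟩ := next β
  have hγ : α + S.half ≤ γ := by
    by_contra h
    have := hmax γ ⟨by omega, by omega, c, hc⟩
    omega
  exact ⟨a, b, c, α, β, γ, ha, hb, hc, ha.ne_of_lt hb hβ1 hβ2,
    ha.ne_of_lt_add_period hc hγ (by omega), hb.ne_of_lt hc hγ1 hγ2.le, hγ, hγ2.le, hβ2⟩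

/-- The sets `C' ∩ A`, `A' ∩ B`, `B' ∩ C` are pairwise disjoint, because any two of them lie in
opposite members of one of the given disjoint pairs. So their sizes add up to at most that of `V`.
-/
theorem three_mul_le_card_sdiff {α : Type*} [DecidableEq α] {V A B C A' B' C' : Finset α} {j : ℕ}
    (hA : A ⊆ V) (hB : B ⊆ V) (hC : C ⊆ V) (hA' : A'.card = j) (hB' : B'.card = j)
    (hC' : C'.card = j) (dA : Disjoint A A') (dB : Disjoint B B') (dC : Disjoint C C') :
    3 * j ≤ (C' \ A).card + (A' \ B).card + (B' \ C).card + V.card := by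
  have h1 := Finset.card_sdiff_add_card_inter C' A
  have h2 := Finset.card_sdiff_add_card_inter A' B
  have h3 := Finset.card_sdiff_add_card_inter B' C
  have h4 : (C' ∩ A).card + (A' ∩ B).card + (B' ∩ C).card ≤ V.card := by
    rw [Finset.disjoint_left] at dA dB dC
    rw [← Finset.card_union_of_disjoint, ← Finset.card_union_of_disjoint]
    · refine Finset.card_le_card fun x => ?_
      simp only [Finset.mem_union, Finset.mem_inter]
      rintro ((h | h) | h)
      · exact hA h.2
      · exact hB h.2
      · exact hC h.2
    · rw [Finset.disjoint_left]
      intro x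
      simp only [Finset.mem_union, Finset.mem_inter]
      rintro (h | h) h'
      · exact dC h'.2 h.1
      · exact dB h.2 h'.1
    · rw [Finset.disjoint_left]
      intro x
      simp only [Finset.mem_inter]
      rintro h h'
      exact dA h.2 h'.1
  omega

/-- A label `z` with few labels of `W \ T` to its left has to its left only those labels of `T` that
are outside `R`, if the labels of `R` have many labels of `W` to their left. -/
theorem rank_le_rank_sdiff_add (S : SimpleAllowableSequence n) {W T R : Finset (Fin n)} {k : ℕ}
    {t : ℤ} {z : Fin n} (hT : T ⊆ W) (hR : R ⊆ T) (hTc : T.card ≤ 3)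
    (hfar : ∀ x ∈ R, k < S.rank W t x) (hz : S.rank (W \ T) t z + 2 ≤ k) :
    S.rank W t z + R.card ≤ S.rank (W \ T) t z + T.card := by
  classical
  have h1 : S.rank W t z = S.rank (W \ T) t z + (T.filter fun x => S.pos t x < S.pos t z).card := by
    unfold rank
    rw [← Finset.card_union_of_disjoint, ← Finset.filter_union, Finset.sdiff_union_of_subset hT]
    exact Finset.disjoint_filter_filter Finset.sdiff_disjoint
  have h2 := Finset.card_filter_le T fun x => S.pos t x < S.pos t z
  -- Since |T| ≤ 3, the rank of `z` in `W` is at most k + 1. A label of `R` to its left would have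
  -- rank at least k + 1 and push `z` to at least k + 2.
  have h3 : (T.filter fun x => S.pos t x < S.pos t z) ⊆ T \ R := by
    intro x hx
    rw [Finset.mem_filter] at hx
    refine Finset.mem_sdiff.2 ⟨hx.1, fun hxR => ?_⟩
    have h4 := hfar x hxR
    have h5 := S.rank_lt_rank (hT hx.1) hx.2
    omega
  have h6 := Finset.card_le_card h3
  have h7 := Finset.card_sdiff_add_card_eq_card hR
  omega

open Classical in
/-- Removal of three labels that are extreme at suitable times. -/
theorem numShallow_recursion (S : SimpleAllowableSequence n) {W : Finset (Fin n)} {k : ℕ}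
    (hk : 2 * k + 2 ≤ W.card) (hk1 : 1 ≤ k) :
    ∃ V : Finset (Fin n), V.card + 3 = W.card ∧
      6 * k + S.numShallow V (k - 2) + (3 * k - W.card) ≤ S.numShallow W k + 3 := by
  obtain ⟨a, b, c, α, β, γ, ha, hb, hc, hab, hac, hbc, h1, h2, h3⟩ := S.exists_three_exits hk hk1
  have hN : 0 ≤ S.half := by positivity
  have hT : ({a, b, c} : Finset (Fin n)) ⊆ W := by
    intro x
    simp only [Finset.mem_insert, Finset.mem_singleton]
    rintro (rfl | rfl | rfl)
    exacts [ha.1, hb.1, hc.1]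
  have hTc : ({a, b, c} : Finset (Fin n)).card = 3 := Finset.card_eq_three.2
    ⟨a, b, c, hab, hac, hbc, rfl⟩
  have hV : (W \ {a, b, c}).card + 3 = W.card := by
    rw [← hTc]; exact Finset.card_sdiff_add_card_eq_card hT
  refine ⟨W \ {a, b, c}, hV, ?_⟩
  have hfa : ∀ t, α ≤ t → t < α + S.half → k < S.rank W t a := ha.2.2.2
  have hfb : ∀ t, β ≤ t → t < β + S.half → k < S.rank W t b := hb.2.2.2
  have hfc : ∀ t, γ ≤ t → t < γ + S.half → k < S.rank W t c := hc.2.2.2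
  -- The far halfperiod of `c` wraps around to the beginning of the period that starts at α.
  have hfc' : ∀ t, γ - 2 * S.half ≤ t → t < γ - S.half → k < S.rank W t c := by
    intro t ht1 ht2
    rw [← rank_add_period]
    exact hfc _ (by omega) (by omega)
  have one : ∀ t z x, x ∈ ({a, b, c} : Finset (Fin n)) → k < S.rank W t x →
      S.rank (W \ {a, b, c}) t z + 2 ≤ k → S.rank W t z ≤ S.rank (W \ {a, b, c}) t z + 2 := by
    intro t z x hx hfar hz
    have := S.rank_le_rank_sdiff_add hT (Finset.singleton_subset_iff.2 hx) hTc.le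
      (by simpa using hfar) hz
    rw [Finset.card_singleton, hTc] at this
    omega
  have two : ∀ t z x y, x ∈ ({a, b, c} : Finset (Fin n)) → y ∈ ({a, b, c} : Finset (Fin n)) →
      x ≠ y → k < S.rank W t x → k < S.rank W t y →
      S.rank (W \ {a, b, c}) t z + 2 ≤ k → S.rank W t z ≤ S.rank (W \ {a, b, c}) t z + 1 := by
    intro t z x y hx hy hxy hfx hfy hz
    have := S.rank_le_rank_sdiff_add (R := {x, y}) hT
      (Finset.insert_subset hx (Finset.singleton_subset_iff.2 hy)) hTc.le
      (by simpa using ⟨hfx, hfy⟩) hz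
    rw [Finset.card_pair hxy, hTc] at this
    omega
  set V := W \ {a, b, c} with hVdef
  have hVW : ∀ x, x ∈ V → x ∈ W := fun x hx => (Finset.mem_sdiff.1 hx).1
  set G1 := (Finset.Ico α (γ - S.half)).filter fun t => S.IsEvent V (k - 1) t with hG1
  set G2 := (Finset.Ico β (α + S.half)).filter fun t => S.IsEvent V (k - 1) t with hG2
  set G3 := (Finset.Ico γ (β + S.half)).filter fun t => S.IsEvent V (k - 1) t with hG3
  set D := (Finset.Ico α (α + 2 * S.half)).filter fun t => S.IsShallow V (k - 2) t with hD
  set I := (Finset.Ico α (α + 2 * S.half)).filter fun t =>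
      S.IsShallow W k t ∧ ¬ (S.lo t ∈ V ∧ S.hi t ∈ V) with hI
  have cI : 6 * k ≤ I.card + 3 := S.card_shallow_three_ge (by omega) hab hac hbc ha.1 hb.1 hc.1
    ha.2.1 hb.2.1 hc.2.1 α
  have cD : S.numShallow V (k - 2) = D.card := S.numShallow_eq V (k - 2) α
  -- Each window starts at one exit and ends a halfperiod away from another, where the first `k - 1`
  -- labels of `V` are disjoint from those at that other exit. Hence these initial sets must change:
  -- in total by at least 3(k - 1) - |V| = 3k - |W|.
  have cG : 3 * k - W.card ≤ G1.card + G2.card + G3.card := by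
    have e1 : (S.first V (k - 1) (γ - S.half) \ S.first V (k - 1) α).card ≤ G1.card :=
      S.card_first_sdiff_le V (k - 1) (by omega : α ≤ γ - S.half)
    have e2 : (S.first V (k - 1) (α + S.half) \ S.first V (k - 1) β).card ≤ G2.card :=
      S.card_first_sdiff_le V (k - 1) (by omega : β ≤ α + S.half)
    have e3 : (S.first V (k - 1) (β + S.half) \ S.first V (k - 1) γ).card ≤ G3.card :=
      S.card_first_sdiff_le V (k - 1) (by omega : γ ≤ β + S.half)
    have hd : Disjoint (S.first V (k - 1) γ) (S.first V (k - 1) (γ - S.half)) := by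
      have := S.disjoint_first_add_half (by omega : 2 * (k - 1) ≤ V.card) (γ - S.half)
      rw [sub_add_cancel] at this
      exact this.symm
    have e4 := three_mul_le_card_sdiff (j := k - 1)
      (S.first_subset V (k - 1) α)
      (S.first_subset V (k - 1) β)
      (S.first_subset V (k - 1) γ)
      (S.card_first (by omega) (α + S.half)) (S.card_first (by omega) (β + S.half))
      (S.card_first (by omega) (γ - S.half))
      (S.disjoint_first_add_half (by omega) α) (S.disjoint_first_add_half (by omega) β) hd
    omega
  have d12 : Disjoint G1 G2 := by
    rw [Finset.disjoint_left]
    intro t ht ht'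
    simp only [hG1, hG2, Finset.mem_filter, Finset.mem_Ico] at ht ht'
    omega
  have d123 : Disjoint (G1 ∪ G2) G3 := by
    rw [Finset.disjoint_left]
    intro t ht ht'
    simp only [hG1, hG2, hG3, Finset.mem_union, Finset.mem_filter, Finset.mem_Ico] at ht ht'
    omega
  have hGV : ∀ t ∈ G1 ∪ G2 ∪ G3, S.IsEvent V (k - 1) t := by
    intro t ht
    simp only [hG1, hG2, hG3, Finset.mem_union, Finset.mem_filter] at ht
    tauto
  have dDG : Disjoint D (G1 ∪ G2 ∪ G3) := by
    rw [Finset.disjoint_left]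
    intro t ht ht'
    have e1 := (hGV t ht').2.2
    have e2 := (Finset.mem_filter.1 ht).2.2.2
    omega
  have dI : Disjoint I (D ∪ (G1 ∪ G2 ∪ G3)) := by
    rw [Finset.disjoint_left]
    intro t ht ht'
    have e1 := (Finset.mem_filter.1 ht).2.2
    rcases Finset.mem_union.1 ht' with h | h
    · have e2 := (Finset.mem_filter.1 h).2
      exact e1 ⟨e2.1, e2.2.1⟩
    · have e2 := hGV t h
      exact e1 ⟨e2.1, e2.2.1⟩
  have hsub : I ∪ (D ∪ (G1 ∪ G2 ∪ G3)) ⊆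
      (Finset.Ico α (α + 2 * S.half)).filter fun t => S.IsShallow W k t := by
    intro t ht
    rw [Finset.mem_union, Finset.mem_union] at ht
    rw [Finset.mem_filter]
    rcases ht with h | h | h
    · rw [hI, Finset.mem_filter] at h
      exact ⟨h.1, h.2.1⟩
    · rw [hD, Finset.mem_filter, Finset.mem_Ico] at h
      obtain ⟨h, h4, h5, h6⟩ := h
      refine ⟨Finset.mem_Ico.2 h, hVW _ h4, hVW _ h5, ?_⟩
      -- At every time of the period one deleted label is far, so at most two of them add to the
      -- rank.
      have : S.rank W t (S.lo t) ≤ S.rank V t (S.lo t) + 2 := by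
        by_cases h7 : t < α + S.half
        · exact one t _ a (by simp) (hfa t h.1 h7) (by omega)
        · by_cases h8 : t < β + S.half
          · exact one t _ b (by simp) (hfb t (by omega) h8) (by omega)
          · exact one t _ c (by simp) (hfc t (by omega) (by omega)) (by omega)
      omega
    · obtain ⟨h4, h5, h6⟩ := hGV t h
      rw [Finset.mem_union, Finset.mem_union, hG1, hG2, hG3, Finset.mem_filter, Finset.mem_filter,
        Finset.mem_filter, Finset.mem_Ico, Finset.mem_Ico, Finset.mem_Ico] at h
      -- In each window two far halfperiods overlap, so only one deleted label can add to the rank k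
      -- - 2 in `V`.
      have : S.rank W t (S.lo t) ≤ S.rank V t (S.lo t) + 1 := by
        rcases h with (⟨h, -⟩ | ⟨h, -⟩) | ⟨h, -⟩
        · exact two t _ a c (by simp) (by simp) hac (hfa t (by omega) (by omega))
            (hfc' t (by omega) (by omega)) (by omega)
        · exact two t _ a b (by simp) (by simp) hab (hfa t (by omega) (by omega))
            (hfb t (by omega) (by omega)) (by omega)
        · exact two t _ b c (by simp) (by simp) hbc (hfb t (by omega) (by omega))
            (hfc t (by omega) (by omega)) (by omega)
      exact ⟨Finset.mem_Ico.2 (by omega), hVW _ h4, hVW _ h5, by omega⟩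
  have hcard := Finset.card_le_card hsub
  rw [Finset.card_union_of_disjoint dI, Finset.card_union_of_disjoint dDG,
    Finset.card_union_of_disjoint d123, Finset.card_union_of_disjoint d12] at hcard
  rw [S.numShallow_eq W k α, cD]
  omega

/-- Induction along `numShallow_recursion`, from (k, |W|) to (k - 2, |W| - 3). The main term
3k(k+1)/2 has increment 6k - 3. The difference d = 3k - |W| drops by 3, and d(d+3)/6 has increment
d. -/
theorem numShallow_ge (S : SimpleAllowableSequence n) (k : ℕ) (W : Finset (Fin n))
    (hk : 2 * k + 2 ≤ W.card) :
    (9 * k * (k + 1) : ℤ) ≤ 6 * S.numShallow W k ∧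
      (W.card ≤ 3 * k + 3 → (9 * k * (k + 1) + (3 * k - W.card) * (3 * k - W.card + 3) : ℤ) ≤
        6 * S.numShallow W k) := by
  induction k using Nat.strong_induction_on generalizing W with
  | _ k ih =>
    rcases Nat.eq_zero_or_pos k with rfl | hk1
    · refine ⟨by simp, fun h => ?_⟩
      have h1 : (2 : ℤ) ≤ W.card := by exact_mod_cast hk
      have h2 : (W.card : ℤ) ≤ 3 := by exact_mod_cast h
      have h3 : (0 : ℤ) ≤ S.numShallow W 0 := by positivity
      push_cast
      nlinarith
    · obtain ⟨V, hV, hrec⟩ := S.numShallow_recursion hk hk1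
      rcases (show k = 1 ∨ 2 ≤ k by omega) with rfl | hk2
      · have h3 : 3 ≤ S.numShallow W 1 := by omega
        have h3' : (3 : ℤ) ≤ S.numShallow W 1 := by exact_mod_cast h3
        refine ⟨by push_cast; linarith, fun h => ?_⟩
        have h1 : (4 : ℤ) ≤ W.card := by exact_mod_cast hk
        have h2 : (W.card : ℤ) ≤ 6 := by exact_mod_cast h
        push_cast
        nlinarith
      · obtain ⟨j, rfl⟩ : ∃ j, k = j + 2 := ⟨k - 2, by omega⟩
        obtain ⟨ih1, ih2⟩ := ih j (by omega) V (by omega)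
        simp only [Nat.add_sub_cancel] at hrec
        have e : (V.card : ℤ) = W.card - 3 := by omega
        -- The truncated difference in the recursion is nonnegative, which gives `r1`, and at least
        -- the integer difference, which gives `r2`.
        have r1 : (6 * (j + 2) + S.numShallow V j : ℤ) ≤ S.numShallow W (j + 2) + 3 := by
          have : 6 * (j + 2) + S.numShallow V j ≤ S.numShallow W (j + 2) + 3 := by omega
          exact_mod_cast this
        have r2 : (6 * (j + 2) + S.numShallow V j + (3 * (j + 2) - W.card) : ℤ) ≤
            S.numShallow W (j + 2) + 3 := by omega
        have p1 : (9 * ((j + 2 : ℕ) : ℤ) * (((j + 2 : ℕ) : ℤ) + 1)) ≤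
            6 * S.numShallow W (j + 2) := by push_cast; nlinarith
        refine ⟨p1, fun h => ?_⟩
        by_cases hd : W.card ≤ 3 * (j + 2)
        · have ih2 := ih2 (by omega)
          rw [e] at ih2
          push_cast
          nlinarith
        -- Here -3 ≤ d < 0, so the correction d(d+3) is not positive and `p1` suffices.
        · have h1 : (W.card : ℤ) ≤ 3 * (j + 2) + 3 := by exact_mod_cast h
          have h2 : (3 * (j + 2) + 1 : ℤ) ≤ W.card := by exact_mod_cast (by omega)
          push_cast at p1 ⊢
          nlinarith
-- Central positions: central against border transpositions.
/-- At time `t` the label `x` is in one of the positions from the `m`-th to the `m`-th from the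
end. -/
def IsCentral (S : SimpleAllowableSequence n) (m : ℕ) (t : ℤ) (x : Fin n) : Prop :=
  m ≤ S.pos t x + 1 ∧ S.pos t x + m ≤ n

/-- The transposition at time `t` exchanges two central labels. -/
def IsCentralSwap (S : SimpleAllowableSequence n) (m : ℕ) (t : ℤ) : Prop :=
  m ≤ S.pos t (S.lo t) + 1 ∧ S.pos t (S.lo t) + 1 + m ≤ n

/-- The transposition at time `t` exchanges a central label and one that is not. -/
def IsBorderSwap (S : SimpleAllowableSequence n) (m : ℕ) (t : ℤ) : Prop :=
  S.pos t (S.lo t) + 2 = m ∨ S.pos t (S.lo t) + m = n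

theorem isCentral_add_half (S : SimpleAllowableSequence n) (m : ℕ) (t : ℤ) (x : Fin n) :
    S.IsCentral m (t + S.half) x ↔ S.IsCentral m t x := by
  have := S.pos_add_half t x
  unfold IsCentral
  omega

theorem isCentral_lo_of_isCentralSwap (S : SimpleAllowableSequence n) {m : ℕ} {t : ℤ}
    (h : S.IsCentralSwap m t) : S.IsCentral m t (S.lo t) := by
  unfold IsCentralSwap at h
  unfold IsCentral
  omega

theorem isCentral_hi_of_isCentralSwap (S : SimpleAllowableSequence n) {m : ℕ} {t : ℤ}
    (h : S.IsCentralSwap m t) : S.IsCentral m t (S.hi t) := by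
  have := S.pos_hi t
  unfold IsCentralSwap at h
  unfold IsCentral
  omega

theorem isCentral_succ_iff (S : SimpleAllowableSequence n) {m : ℕ} {t : ℤ}
    (h : ¬ S.IsBorderSwap m t) (hm : 2 * m ≤ n) (x : Fin n) :
    S.IsCentral m (t + 1) x ↔ S.IsCentral m t x := by
  have h1 := S.pos_succ_lo t
  have h2 := S.pos_succ_hi t
  have h3 := S.pos_hi t
  unfold IsBorderSwap at h
  unfold IsCentral
  by_cases hl : x = S.lo t
  · subst hl; omega
  · by_cases hh : x = S.hi t
    · subst hh; omega
    · rw [S.pos_succ_of_ne hl hh]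

/-- At a border transposition only one label ceases to be central. -/
theorem exists_isCentral_succ (S : SimpleAllowableSequence n) {m : ℕ} {t : ℤ}
    (h : S.IsBorderSwap m t) (hm : 2 * m ≤ n) : ∃ w, S.IsCentral m t w ∧
      ∀ x, x ≠ w → S.IsCentral m t x → S.IsCentral m (t + 1) x := by
  have h1 := S.pos_succ_lo t
  have h2 := S.pos_succ_hi t
  have h3 := S.pos_hi t
  unfold IsBorderSwap at h
  unfold IsCentral
  rcases h with h | h
  · refine ⟨S.hi t, by omega, fun x hx hc => ?_⟩
    have hl : x ≠ S.lo t := by rintro rfl; omega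
    rwa [S.pos_succ_of_ne hl hx]
  · refine ⟨S.lo t, by omega, fun x hx hc => ?_⟩
    have hl : x ≠ S.hi t := by rintro rfl; omega
    rwa [S.pos_succ_of_ne hx hl]

open Classical in
theorem card_isCentral_le (S : SimpleAllowableSequence n) {m : ℕ} (hm : 1 ≤ m) (hmn : 2 * m ≤ n)
    (t : ℤ) : (Finset.univ.filter fun x => S.IsCentral m t x).card ≤ n - 2 * m + 2 := by
  have : (Finset.univ.filter fun x => S.IsCentral m t x).card ≤
      (Finset.Icc (m - 1) (n - m)).card := by
    refine Finset.card_le_card_of_injOn (S.pos t) ?_ (S.pos_injective t).injOn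
    intro x hx
    have hx := (Finset.mem_filter.1 hx).2
    unfold IsCentral at hx
    simp only [Finset.coe_Icc, Set.mem_Icc]
    omega
  rw [Nat.card_Icc] at this
  omega

open Classical in
/-- The pairs that have been transposed since they have both been central. -/
noncomputable def session (S : SimpleAllowableSequence n) (m : ℕ) (t : ℤ) :
    Finset (Sym2 (Fin n)) :=
  Finset.univ.filter fun e => ∃ s, s < t ∧ s(S.lo s, S.hi s) = e ∧
    ∀ r, s ≤ r → r ≤ t → ∀ x ∈ e, S.IsCentral m r x

theorem mem_session (S : SimpleAllowableSequence n) {m : ℕ} {t : ℤ} {e : Sym2 (Fin n)} :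
    e ∈ S.session m t ↔ ∃ s, s < t ∧ s(S.lo s, S.hi s) = e ∧
      ∀ r, s ≤ r → r ≤ t → ∀ x ∈ e, S.IsCentral m r x := by
  simp [session]

/-- This inclusion closes the telescoping sum over a period in `card_isCentralSwap_le`. -/
theorem session_add_period_subset (S : SimpleAllowableSequence n) (m : ℕ) (t : ℤ) :
    S.session m (t + 2 * S.half) ⊆ S.session m t := by
  intro e he
  rw [mem_session] at he ⊢
  obtain ⟨s, h1, h2, h3⟩ := he
  refine ⟨s - 2 * S.half, by omega, ?_, fun r hr1 hr2 x hx => ?_⟩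
  · rw [← S.lo_add_period, ← S.hi_add_period]
    simpa using h2
  · have := h3 (r + 2 * S.half) (by omega) (by omega) x hx
    rwa [two_mul, ← add_assoc, isCentral_add_half, isCentral_add_half] at this

theorem mem_session_succ (S : SimpleAllowableSequence n) {m : ℕ} {t : ℤ} {e : Sym2 (Fin n)}
    (he : e ∈ S.session m t) (h : ∀ x ∈ e, S.IsCentral m (t + 1) x) : e ∈ S.session m (t + 1) := by
  rw [mem_session] at he ⊢
  obtain ⟨s, h1, h2, h3⟩ := he
  refine ⟨s, by omega, h2, fun r hr1 hr2 => ?_⟩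
  rcases (show r ≤ t ∨ r = t + 1 by omega) with hr | rfl
  · exact h3 r hr1 hr
  · exact h

theorem isCentral_of_mem_session (S : SimpleAllowableSequence n) {m : ℕ} {t : ℤ}
    {e : Sym2 (Fin n)} (he : e ∈ S.session m t) {x : Fin n} (hx : x ∈ e) : S.IsCentral m t x := by
  rw [mem_session] at he
  obtain ⟨s, h1, -, h3⟩ := he
  exact h3 t h1.le le_rfl x hx

/-- A label that is central during a halfperiod is always central. -/
theorem isCentral_of_forall_half (S : SimpleAllowableSequence n) (hn : 2 ≤ n) {m : ℕ} {s : ℤ}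
    {x : Fin n} (h : ∀ r, s ≤ r → r < s + S.half → S.IsCentral m r x) (r : ℤ) :
    S.IsCentral m r x := by
  have hpos : 0 < S.half := by
    have := Nat.choose_pos hn
    exact_mod_cast this
  have hper : Function.Periodic (fun t => S.IsCentral m t x) S.half := fun t =>
    propext (S.isCentral_add_half m t x)
  obtain ⟨y, hy, he⟩ := hper.exists_mem_Ico hpos r s
  exact he ▸ h y hy.1 hy.2

/-- No pair is lost, as the central labels stay the same. The swapped pair is new: otherwise its
labels would have been central ever since an earlier swap, at least a halfperiod ago, and hence
would be central always. -/
theorem card_session_succ_of_isCentralSwap (S : SimpleAllowableSequence n) (hn : 2 ≤ n) {m : ℕ}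
    (hm : 2 * m ≤ n) (hperm : ∀ x y : Fin n, x ≠ y → ∃ t, ¬ (S.IsCentral m t x ∧ S.IsCentral m t y))
    {t : ℤ} (h : S.IsCentralSwap m t) : (S.session m t).card + 1 ≤ (S.session m (t + 1)).card := by
  classical
  have hb : ¬ S.IsBorderSwap m t := by
    unfold IsBorderSwap; unfold IsCentralSwap at h; omega
  have hnot : s(S.lo t, S.hi t) ∉ S.session m t := by
    intro he
    rw [mem_session] at he
    obtain ⟨s, h1, h2, h3⟩ := he
    have hs : s + S.half ≤ t := by
      by_contra hlt
      have := S.eq_of_swap_eq h1.le (by omega) h2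
      omega
    obtain ⟨r, hr⟩ := hperm _ _ (S.lo_ne_hi t)
    exact hr ⟨S.isCentral_of_forall_half hn (s := s)
        (fun r h4 h5 => h3 r h4 (by omega) _ (Sym2.mem_mk_left _ _)) r,
      S.isCentral_of_forall_half hn (s := s)
        (fun r h4 h5 => h3 r h4 (by omega) _ (Sym2.mem_mk_right _ _)) r⟩
  rw [← Finset.card_insert_of_notMem hnot]
  refine Finset.card_le_card fun e he => ?_
  rcases Finset.mem_insert.1 he with rfl | he
  · rw [mem_session]
    refine ⟨t, by omega, rfl, fun r h1 h2 x hx => ?_⟩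
    have hx' : S.IsCentral m t x := by
      rcases Sym2.mem_iff.1 hx with rfl | rfl
      · exact S.isCentral_lo_of_isCentralSwap h
      · exact S.isCentral_hi_of_isCentralSwap h
    rcases (show r = t ∨ r = t + 1 by omega) with rfl | rfl
    · exact hx'
    · exact (S.isCentral_succ_iff hb hm x).2 hx'
  · exact S.mem_session_succ he fun x hx =>
      (S.isCentral_succ_iff hb hm x).2 (S.isCentral_of_mem_session he hx)

/-- Only pairs containing the departing label are lost, and its partner is one of the at most n - 2m
+ 1 other central labels. -/
theorem card_session_succ_of_isBorderSwap (S : SimpleAllowableSequence n) {m : ℕ} (hm1 : 1 ≤ m)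
    (hm : 2 * m ≤ n) {t : ℤ} (h : S.IsBorderSwap m t) :
    (S.session m t).card ≤ (S.session m (t + 1)).card + (n - 2 * m + 1) := by
  classical
  obtain ⟨w, hw, hstay⟩ := S.exists_isCentral_succ h hm
  have hsub : S.session m t ⊆ S.session m (t + 1) ∪
      ((Finset.univ.filter fun x => S.IsCentral m t x).erase w).image fun z => s(w, z) := by
    intro e he
    rw [Finset.mem_union]
    by_cases hwe : w ∈ e
    · right
      obtain ⟨z, rfl⟩ := hwe
      have hz := S.isCentral_of_mem_session he (Sym2.mem_mk_right w z)
      refine Finset.mem_image.2 ⟨z, Finset.mem_erase.2 ⟨?_, by simpa using hz⟩, rfl⟩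
      rintro rfl
      rw [mem_session] at he
      obtain ⟨s, -, h2, -⟩ := he
      have : (s(S.lo s, S.hi s)).IsDiag := by rw [h2]; simp
      exact S.lo_ne_hi s (by simpa using this)
    · left
      exact S.mem_session_succ he fun x hx =>
        hstay x (by rintro rfl; exact hwe hx) (S.isCentral_of_mem_session he hx)
  have h1 := Finset.card_le_card hsub
  have h2 := Finset.card_union_le (S.session m (t + 1))
    (((Finset.univ.filter fun x => S.IsCentral m t x).erase w).image fun z => s(w, z))
  have h3 : (((Finset.univ.filter fun x => S.IsCentral m t x).erase w).image
      fun z => s(w, z)).card ≤ _ := Finset.card_image_le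
  have h4 := Finset.card_erase_add_one (s := Finset.univ.filter fun x => S.IsCentral m t x)
    (a := w) (by simpa using hw)
  have h5 := S.card_isCentral_le hm1 hm t
  omega

open Classical in
/-- If no two labels are always central, the central transpositions are at most `n - 2 m + 1` times
as many as the border transpositions. -/
theorem card_isCentralSwap_le (S : SimpleAllowableSequence n) (hn : 2 ≤ n) {m : ℕ} (hm1 : 1 ≤ m)
    (hm : 2 * m ≤ n)
    (hperm : ∀ x y : Fin n, x ≠ y → ∃ t, ¬ (S.IsCentral m t x ∧ S.IsCentral m t y)) :
    ((Finset.Ico (0 : ℤ) (0 + 2 * S.half)).filter fun t => S.IsCentralSwap m t).card ≤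
      (n - 2 * m + 1) *
        ((Finset.Ico (0 : ℤ) (0 + 2 * S.half)).filter fun t => S.IsBorderSwap m t).card := by
  -- The size of `session` serves as a potential, and its changes are summed over a period.
  have step : ∀ t, (S.session m t).card + (if S.IsCentralSwap m t then 1 else 0) ≤
      (S.session m (t + 1)).card + (n - 2 * m + 1) * (if S.IsBorderSwap m t then 1 else 0) := by
    intro t
    by_cases hc : S.IsCentralSwap m t
    · rw [if_pos hc]
      exact (S.card_session_succ_of_isCentralSwap hn hm hperm hc).trans (Nat.le_add_right _ _)
    · rw [if_neg hc, add_zero]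
      by_cases hb : S.IsBorderSwap m t
      · rw [if_pos hb, mul_one]
        exact S.card_session_succ_of_isBorderSwap hm1 hm hb
      · rw [if_neg hb, mul_zero, add_zero]
        exact Finset.card_le_card fun e he => S.mem_session_succ he fun x hx =>
          (S.isCentral_succ_iff hb hm x).2 (S.isCentral_of_mem_session he hx)
  have sum : ∀ L : ℕ, (S.session m 0).card +
      ((Finset.Ico (0 : ℤ) L).filter fun t => S.IsCentralSwap m t).card ≤
      (S.session m L).card + (n - 2 * m + 1) *
        ((Finset.Ico (0 : ℤ) L).filter fun t => S.IsBorderSwap m t).card := by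
    intro L
    induction L with
    | zero => simp
    | succ L ih =>
      have e : Finset.Ico (0 : ℤ) ((L + 1 : ℕ) : ℤ) = insert (L : ℤ) (Finset.Ico 0 (L : ℤ)) := by
        ext x; simp only [Finset.mem_Ico, Finset.mem_insert]; push_cast; omega
      have hs := step L
      have hnot : ∀ P : ℤ → Prop, (L : ℤ) ∉ (Finset.Ico (0 : ℤ) L).filter P := by
        intro P; simp
      rw [e, Finset.filter_insert, Finset.filter_insert]
      push_cast
      by_cases hc : S.IsCentralSwap m L <;> by_cases hb : S.IsBorderSwap m L <;>
        simp only [hc, hb, if_true, if_false, Finset.card_insert_of_notMem (hnot _)] at hs ⊢ <;>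
        linarith
  have hL : (0 + 2 * S.half : ℤ) = ((2 * n.choose 2 : ℕ) : ℤ) := by push_cast; ring
  have hfin := sum (2 * n.choose 2)
  have hle : (S.session m ((2 * n.choose 2 : ℕ) : ℤ)).card ≤ (S.session m 0).card := by
    rw [← hL]; exact Finset.card_le_card (S.session_add_period_subset m 0)
  rw [hL]
  omega

/-! ### Counting a period, and the case of two permanently central labels. -/

open Classical in
theorem two_mul_numHalvingLines (S : SimpleAllowableSequence n) (hn : 2 ≤ n) :
    2 * S.numHalvingLines =
      ((Finset.Ico (0 : ℤ) (0 + 2 * S.half)).filter fun t => S.IsCentralSwap (n / 2) t).card := by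
  have hN : 0 ≤ S.half := by positivity
  have h0 := S.numEdgesFrom_eq_numEdges (n / 2 - 1) S.half
  have h1 : S.numEdgesFrom (n / 2 - 1) 0 = S.numEdges (n / 2 - 1) := rfl
  unfold numHalvingLines
  rw [two_mul]
  nth_rewrite 1 [← h1]
  rw [← h0]
  unfold numEdgesFrom
  rw [← Finset.card_union_of_disjoint, ← Finset.filter_union]
  · rw [Nat.sub_add_cancel (by omega)]
    congr 1
    ext t
    simp only [Finset.mem_filter, Finset.mem_union, Finset.mem_Ico]
    simp only [IsCritical, isTransposition_iff, IsCentralSwap]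
    have := S.pos_hi t
    have := S.pos_lt t (S.hi t)
    unfold half
    omega
  · rw [Finset.disjoint_left]
    intro t ht ht'
    rw [Finset.mem_filter, Finset.mem_Ico] at ht ht'
    have e1 := ht.1.2
    have e2 := ht'.1.1
    change t < 0 + S.half at e1
    omega

open Classical in
/-- All transpositions of a period are shallow from the left, border, central, or shallow from the
right. -/
theorem two_mul_choose_eq (S : SimpleAllowableSequence n) {m : ℕ} (hm1 : 2 ≤ m)
    (hm : 2 * m ≤ n) : 2 * n.choose 2 = 2 * S.numShallow Finset.univ (m - 2) +
      ((Finset.Ico (0 : ℤ) (0 + 2 * S.half)).filter fun t => S.IsBorderSwap m t).card +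
      ((Finset.Ico (0 : ℤ) (0 + 2 * S.half)).filter fun t => S.IsCentralSwap m t).card := by
  have hN : 0 ≤ S.half := by positivity
  set J := Finset.Ico (0 : ℤ) (0 + 2 * S.half) with hJ
  have hsh : ∀ t, S.IsShallow Finset.univ (m - 2) t ↔ S.pos t (S.lo t) + 2 < m := by
    intro t
    simp only [IsShallow, Finset.mem_univ, true_and, rank_univ]
    omega
  have e1 : S.numShallow Finset.univ (m - 2) =
      (J.filter fun t => S.pos t (S.lo t) + 2 < m).card := by
    simp only [numShallow, hsh, hJ]
  -- A shift by a halfperiod reflects positions, so the right end has as many transpositions as the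
  -- left.
  have e2 : S.numShallow Finset.univ (m - 2) =
      (J.filter fun t => n < S.pos t (S.lo t) + m).card := by
    rw [S.numShallow_eq _ _ S.half]
    simp only [hsh]
    symm
    refine Finset.card_bij (fun t _ => t + S.half) ?_ ?_ ?_
    · intro t ht
      simp only [hJ, Finset.mem_filter, Finset.mem_Ico] at ht ⊢
      rw [lo_add_half]
      have := S.pos_add_half t (S.hi t)
      have := S.pos_hi t
      omega
    · intro t _ t' _ h; omega
    · intro t ht
      refine ⟨t - S.half, ?_, by omega⟩
      simp only [hJ, Finset.mem_filter, Finset.mem_Ico] at ht ⊢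
      have a1 := S.lo_add_half (t - S.half)
      have a2 := S.pos_add_half (t - S.half) (S.hi (t - S.half))
      have a3 := S.pos_hi (t - S.half)
      rw [← a1, sub_add_cancel] at a2
      rw [← a1, sub_add_cancel] at a3
      omega
  have e3 : J.card = 2 * n.choose 2 := by
    rw [hJ, Int.card_Ico]; unfold half; omega
  have f1 := Finset.card_filter_add_card_filter_not (s := J)
    (fun t => S.pos t (S.lo t) + 2 < m)
  have f2 := Finset.card_filter_add_card_filter_not
    (s := J.filter fun t => ¬ S.pos t (S.lo t) + 2 < m)
    (fun t => n < S.pos t (S.lo t) + m)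
  have f3 := Finset.card_filter_add_card_filter_not
    (s := (J.filter fun t => ¬ S.pos t (S.lo t) + 2 < m).filter
      fun t => ¬ n < S.pos t (S.lo t) + m) (fun t => S.IsBorderSwap m t)
  simp only [Finset.filter_filter] at f2 f3
  have g1 : (J.filter fun t => ¬ S.pos t (S.lo t) + 2 < m ∧ n < S.pos t (S.lo t) + m) =
      J.filter fun t => n < S.pos t (S.lo t) + m := Finset.filter_congr fun t _ => by omega
  have g2 : (J.filter fun t => (¬ S.pos t (S.lo t) + 2 < m ∧ ¬ n < S.pos t (S.lo t) + m) ∧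
      S.IsBorderSwap m t) = J.filter fun t => S.IsBorderSwap m t :=
    Finset.filter_congr fun t _ => by unfold IsBorderSwap; omega
  have g3 : (J.filter fun t => (¬ S.pos t (S.lo t) + 2 < m ∧ ¬ n < S.pos t (S.lo t) + m) ∧
      ¬ S.IsBorderSwap m t) = J.filter fun t => S.IsCentralSwap m t :=
    Finset.filter_congr fun t _ => by unfold IsBorderSwap IsCentralSwap; omega
  rw [g1] at f2
  rw [g2, g3] at f3
  omega

/-- Only as many labels as there are central positions can be central at a time. -/
theorem mem_pair_of_isCentralSwap (S : SimpleAllowableSequence n) {m : ℕ}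
    (hm : 2 * m ≤ n) (hn : n ≤ 2 * m + 1) {x y : Fin n} (hxy : x ≠ y) {t : ℤ}
    (hx : S.IsCentral m t x) (hy : S.IsCentral m t y) (h : S.IsCentralSwap m t) :
    (x ∈ s(S.lo t, S.hi t) ∨ y ∈ s(S.lo t, S.hi t)) ∧
      (n = 2 * m → s(S.lo t, S.hi t) = s(x, y)) := by
  have h1 := S.isCentral_lo_of_isCentralSwap h
  have h2 := S.isCentral_hi_of_isCentralSwap h
  have h3 := S.pos_hi t
  have a1 : S.pos t x ≠ S.pos t y := fun e => hxy (S.pos_inj.1 e)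
  rw [Sym2.mem_iff, Sym2.mem_iff, Sym2.eq_iff]
  simp only [← S.pos_inj (t := t)]
  -- There are only two or three central positions, so two pairs of them always meet, and coincide
  -- if there are just two.
  unfold IsCentral at hx hy h1 h2
  omega

open Classical in
theorem card_swaps_le (S : SimpleAllowableSequence n) (x : Fin n) (i : ℤ) :
    ((Finset.Ico i (i + S.half)).filter fun t => x ∈ s(S.lo t, S.hi t)).card ≤ n - 1 := by
  have hsub : ((Finset.Ico i (i + S.half)).filter fun t => x ∈ s(S.lo t, S.hi t)).image
      (fun t => s(S.lo t, S.hi t)) ⊆ (Finset.univ.erase x).image fun z => s(x, z) := by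
    intro e he
    obtain ⟨t, ht, rfl⟩ := Finset.mem_image.1 he
    have ht := (Finset.mem_filter.1 ht).2
    have hne := S.lo_ne_hi t
    rcases Sym2.mem_iff.1 ht with rfl | rfl
    · exact Finset.mem_image.2 ⟨S.hi t, by simpa using hne.symm, rfl⟩
    · exact Finset.mem_image.2 ⟨S.lo t, by simpa using hne, Sym2.eq_swap⟩
  rw [← Finset.card_image_of_injOn
    ((S.swap_injOn i).mono (Finset.coe_subset.2 (Finset.filter_subset _ _)))]
  refine (Finset.card_le_card hsub).trans (Finset.card_image_le.trans ?_)
  simp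

-- For even n the permanent labels fill the central positions, so every halving transposition swaps
-- this one pair. For odd n each halving transposition involves one of the two labels, and each
-- label takes part in at most n - 1 swaps per halfperiod.
open Classical in
theorem numHalvingLines_le_of_permanent (S : SimpleAllowableSequence n) (hn : 2 ≤ n)
    {x y : Fin n} (hxy : x ≠ y) (h : ∀ t, S.IsCentral (n / 2) t x ∧ S.IsCentral (n / 2) t y) :
    S.numHalvingLines ≤ 2 * (n - 1) ∧ (Even n → S.numHalvingLines ≤ 1) := by
  have hN : 0 ≤ S.half := by positivity
  have key : ∀ t, S.IsCritical (n / 2 - 1 + 1) t →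
      (x ∈ s(S.lo t, S.hi t) ∨ y ∈ s(S.lo t, S.hi t)) ∧
      (n = 2 * (n / 2) → s(S.lo t, S.hi t) = s(x, y)) := by
    intro t ht
    refine S.mem_pair_of_isCentralSwap (by omega) (by omega) hxy (h t).1 (h t).2 ?_
    simp only [IsCritical, isTransposition_iff] at ht
    have := S.pos_hi t
    have := S.pos_lt t (S.hi t)
    unfold IsCentralSwap
    omega
  unfold numHalvingLines numEdges numEdgesFrom
  refine ⟨?_, fun he => ?_⟩
  · have h1 := S.card_swaps_le x 0
    have h2 := S.card_swaps_le y 0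
    refine (Finset.card_le_card ?_).trans ((Finset.card_union_le _ _).trans
      ((add_le_add h1 h2).trans (by omega)))
    intro t ht
    rw [Finset.mem_filter] at ht
    simp only [Finset.mem_union, Finset.mem_filter]
    rcases (key t ht.2).1 with h | h
    · exact Or.inl ⟨ht.1, h⟩
    · exact Or.inr ⟨ht.1, h⟩
  · rw [Finset.card_le_one]
    intro t ht t' ht'
    rw [Finset.mem_filter] at ht ht'
    have hn2 : n = 2 * (n / 2) := by obtain ⟨r, rfl⟩ := he; omega
    exact S.swap_injOn 0 (Finset.mem_coe.2 ht.1) (Finset.mem_coe.2 ht'.1)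
      (((key t ht.2).2 hn2).trans ((key t' ht'.2).2 hn2).symm)

/-- The number `B` of border transpositions in a period, if no two labels are always central. -/
theorem exists_card_border_of_not_permanent (S : SimpleAllowableSequence n) (hn : 8 ≤ n)
    (hperm : ∀ x y : Fin n, x ≠ y →
      ∃ t, ¬ (S.IsCentral (n / 2) t x ∧ S.IsCentral (n / 2) t y)) :
    ∃ B : ℕ, 2 * n.choose 2 = 2 * S.numShallow Finset.univ (n / 2 - 2) + B +
      2 * S.numHalvingLines ∧ 2 * S.numHalvingLines ≤ (n - 2 * (n / 2) + 1) * B := by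
  classical
  have h1 := S.two_mul_choose_eq (m := n / 2) (by omega) (by omega)
  have h2 := S.card_isCentralSwap_le (by omega) (m := n / 2) (by omega) (by omega) hperm
  rw [← S.two_mul_numHalvingLines (by omega)] at h1 h2
  exact ⟨_, h1, h2⟩

end SimpleAllowableSequence

/-! ### Combination of the bounds. -/

theorem mainTheorem3 (n : ℕ) (hn : 8 ≤ n) (S : SimpleAllowableSequence n) :
    (Even n → (S.numHalvingLines : ℤ) ≤ ⌊(1 / 24 : ℝ) * n * (n + 30) - 3⌋) ∧
    (Odd n → (S.numHalvingLines : ℤ) ≤ ⌊(1 / 18 : ℝ) * (n - 3) * (n + 45) + 1 / 9⌋) := by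
  by_cases hperm : ∀ x y : Fin n, x ≠ y →
      ∃ t, ¬ (S.IsCentral (n / 2) t x ∧ S.IsCentral (n / 2) t y)
  · obtain ⟨B, h1, h2⟩ := S.exists_card_border_of_not_permanent hn hperm
    -- With k = ⌊n/2⌋ - 2 the condition n ≤ 3k + 3 holds for all n ≥ 8, with equality at n = 9.
    have h3 := (S.numShallow_ge (n / 2 - 2) Finset.univ (by simp; omega)).2 (by simp; omega)
    rw [Finset.card_univ, Fintype.card_fin] at h3
    have hch : (2 * n.choose 2 : ℤ) = n * (n - 1) := by
      rw [Nat.choose_two_right]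
      have h4 : 2 ∣ n * (n - 1) := (Nat.even_mul_pred_self n).two_dvd
      have h5 : 2 * (n * (n - 1) / 2) = n * (n - 1) := Nat.mul_div_cancel' h4
      zify [show 1 ≤ n by omega] at h5 ⊢
      exact h5
    refine ⟨fun he => ?_, fun ho => ?_⟩
    · obtain ⟨j, rfl⟩ : ∃ j, n = 2 * (j + 4) := by
        obtain ⟨m, rfl⟩ := he; exact ⟨m - 4, by omega⟩
      rw [show 2 * (j + 4) / 2 - 2 = j + 2 by omega] at h1 h3
      rw [show 2 * (j + 4) - 2 * (2 * (j + 4) / 2) + 1 = 1 by omega, one_mul] at h2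
      have h1' : (2 * (2 * (j + 4)).choose 2 : ℤ) = 2 * S.numShallow Finset.univ (j + 2) + B +
        2 * S.numHalvingLines := by exact_mod_cast h1
      rw [hch] at h1'
      have h2' : (2 * S.numHalvingLines : ℤ) ≤ B := by exact_mod_cast h2
      push_cast at h1' h3
      -- Since B ≥ 2h, the count gives 4h ≤ n(n-1) - 2N; here n/2 = j + 4.
      have h4 : (6 * S.numHalvingLines : ℤ) ≤ (j + 4) ^ 2 + 15 * (j + 4) - 18 := by linarith
      have h5 : (6 * S.numHalvingLines : ℝ) ≤ (j + 4) ^ 2 + 15 * (j + 4) - 18 := by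
        exact_mod_cast h4
      rw [Int.le_floor]
      push_cast
      linarith
    · obtain ⟨j, rfl⟩ : ∃ j, n = 2 * (j + 4) + 1 := by
        obtain ⟨m, rfl⟩ := ho; exact ⟨m - 4, by omega⟩
      rw [show (2 * (j + 4) + 1) / 2 - 2 = j + 2 by omega] at h1 h3
      rw [show 2 * (j + 4) + 1 - 2 * ((2 * (j + 4) + 1) / 2) + 1 = 2 by omega] at h2
      have h1' : (2 * (2 * (j + 4) + 1).choose 2 : ℤ) = 2 * S.numShallow Finset.univ (j + 2) + B +
        2 * S.numHalvingLines := by exact_mod_cast h1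
      rw [hch] at h1'
      have h2' : (2 * S.numHalvingLines : ℤ) ≤ 2 * B := by exact_mod_cast h2
      push_cast at h1' h3
      -- Since now only B ≥ h, the count gives 3h ≤ n(n-1) - 2N.
      have h4 : (9 * S.numHalvingLines : ℤ) ≤ 2 * (j + 4) ^ 2 + 44 * (j + 4) - 46 := by linarith
      have h5 : (9 * S.numHalvingLines : ℝ) ≤ 2 * (j + 4) ^ 2 + 44 * (j + 4) - 46 := by
        exact_mod_cast h4
      rw [Int.le_floor]
      push_cast
      linarith
  · push Not at hperm
    obtain ⟨x, y, hxy, hall⟩ := hperm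
    obtain ⟨h1, h2⟩ := S.numHalvingLines_le_of_permanent (by omega) hxy hall
    have hn' : (8 : ℝ) ≤ n := by exact_mod_cast hn
    refine ⟨fun he => ?_, fun ho => ?_⟩
    · have h3 : (S.numHalvingLines : ℝ) ≤ 1 := by exact_mod_cast h2 he
      rw [Int.le_floor]
      push_cast
      nlinarith
    · have h9 : 9 ≤ n := by obtain ⟨m, rfl⟩ := ho; omega
      have h9' : (9 : ℝ) ≤ n := by exact_mod_cast h9
      have h3 : (S.numHalvingLines : ℝ) ≤ 2 * (n - 1) := by
        have : (S.numHalvingLines : ℝ) ≤ ((2 * (n - 1) : ℕ) : ℝ) := by exact_mod_cast h1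
        rwa [Nat.cast_mul, Nat.cast_sub (by omega), Nat.cast_one, Nat.cast_ofNat] at this
      rw [Int.le_floor]
      push_cast
      nlinarith
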